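/- **Theorem (Global convergence of D-GDMax).** Let $m\ge 1$ agents be the nodes of a graph $\mathcal G$, and consider $$\min_{\mathbf x\in\mathbb R^{n_1}}\max_{\mathbf y\in\mathbb R^{n_2}}\ \tfrac1m\sum_{i=1}^m f_i(\mathbf x,\mathbf y)+g(\mathbf x)-h(\mathbf y),$$ where $g,h$ are closed proper convex functions with values in $(-\infty,+\infty]$. For a matrix $\mathbf X\in\mathbb R^{m\times n}$ with rows $\mathbf x_1^\top,\dots,\mathbf x_m^\top$ write $\mathbf x_{\rm avg}=\frac1m\sum_i\mathbf x_i$ and $\mathbf X_\perp=\mathbf X-\mathbf 1\mathbf x_{\rm avg}^\top$. For a function $r$ with values in $(-\infty,+\infty]$ let $\mathrm{prox}_r(\mathbf x)=\arg\min_{\mathbf u}\{r(\mathbf u)+\frac12\|\mathbf u-\mathbf x\|^2\}$. Put $p(\mathbf x)=\max_{\mathbf y}\{\frac1m\sum_i f_i(\mathbf x,\mathbf y)-h(\mathbf y)\}$. Let $\mathbf W=(w_{ij})\in\mathbb R^{m\times m}$ and $L,\mu>0$. Assume: 1. $p+g$ has a minimizer, with finite value. There is an open set $\mathcal Z\supseteq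 \mathrm{dom}(g)\times\mathrm{dom}(h)$ on which every $f_i$ is differentiable with $\|\nabla f_i(\mathbf z)-\nabla f_i(\tilde{\mathbf z})\|\le L\|\mathbf z-\tilde{\mathbf z}\|$. For all $i$, all $\mathbf x\in\mathrm{dom}(g)$ and all $\mathbf y,\tilde{\mathbf y}\in\mathrm{dom}(h)$, $\langle \mathbf y-\tilde{\mathbf y},\nabla_{\mathbf y}f_i(\mathbf x,\mathbf y)-\nabla_{\mathbf y}f_i(\mathbf x,\tilde{\mathbf y})\rangle\le-\mu\|\mathbf y-\tilde{\mathbf y}\|^2$. 2. The relative interior of $\mathrm{dom}(h)$ is nonempty. 3. $w_{ij}=0$ whenever $i\ne j$ are not adjacent in $\mathcal G$; $\rho:=\|\mathbf W-\frac1m\mathbf 1\mathbf 1^\top\|_2<1$; $\mathrm{Null}(\mathbf W-\mathbf I)=\mathrm{Span}\{\mathbf 1\}$ and $\mathbf W^\top\mathbf 1=\mathbf 1$; $\|\mathbf W-\mathbf I\|_2\le 2$. Let $\kappa=L/\mu$ and $$\eta_x=\frac{(1-\rho)^2}{5L\sqrt{1+6\kappa^2}},\qquad \eta_\lambda=\frac{(1-\rho)^2}{L(9\kappa+2)},$$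 and let $\delta_t\ge 0$ satisfy $\sum_{t=0}^\infty\delta_t^2<\infty$. Let $(\mathbf X^t,\mathbf\Lambda^t,\mathbf Y^t,\mathbf V^t)_{t\ge0}$, with rows $\mathbf x_i^t,\mathbf\lambda_i^t,\mathbf y_i^t,\mathbf v_i^t$, be any sequence generated as follows. Initially $\mathbf x_i^0=\mathbf x^0\in\mathrm{dom}(g)$ for all $i$, $\mathbf\lambda_i^0=\mathbf 0$, and $\mathbf v_i^0=\nabla_{\mathbf x}f_i(\mathbf x_i^0,\mathbf y_i^0)$. For all $t\ge 0$ and all $i$, $$\mathbf x_i^{t+1}=\mathrm{prox}_{\eta_xg}\Big(\sum_jw_{ij}\mathbf x_j^t-\eta_x\mathbf v_i^t\Big),\qquad \mathbf\lambda_i^{t+1}=\mathbf\lambda_i^t+\tfrac{L\eta_\lambda}{2\sqrt m}\Big(\sum_jw_{ij}\mathbf y_j^t-\mathbf y_i^t\Big),$$ $$\mathbf v_i^{t+1}=\sum_jw_{ij}\mathbf v_j^t+\nabla_{\mathbf x}f_i(\mathbf x_i^{t+1},\mathbf y_i^{t+1})-\nabla_{\mathbf x}f_i(\mathbf x_i^t,\mathbf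 y_i^t),$$ and $\mathbf y_i^t$ is any point with $\mathrm{dist}(\mathbf 0,\partial d_i^t(\mathbf y_i^t))\le\delta_t$, where $$d_i^t(\mathbf y)=f_i(\mathbf x_i^t,\mathbf y)-h(\mathbf y)-\tfrac{L\sqrt m}{2}\Big\langle\sum_jw_{ji}\mathbf\lambda_j^t-\mathbf\lambda_i^t,\ \mathbf y\Big\rangle,$$ $\partial$ is the superdifferential of a concave function, and the distance to the empty set is $+\infty$. Put $$\Phi(\mathbf X,\mathbf\Lambda,\mathbf Y)=\tfrac1m\sum_{i=1}^m\big(f_i(\mathbf x_i,\mathbf y_i)-h(\mathbf y_i)\big)-\tfrac{L}{2\sqrt m}\langle\mathbf\Lambda,(\mathbf W-\mathbf I)\mathbf Y\rangle,\qquad P(\mathbf x,\mathbf\Lambda)=\max_{\mathbf Y}\Phi(\mathbf 1\mathbf x^\top,\mathbf\Lambda,\mathbf Y),$$ and $\phi(\mathbf x,\mathbf\Lambda)=P(\mathbf x,\mathbf\Lambda)+g(\mathbf x)$. Then every limit point $(\bar{\mathbf X},\bar{\mathbf\Lambda})$ of $(\mathbf X^t,\mathbf\Lambda^t)_{t\ge0}$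 satisfies (i) $\bar{\mathbf X}_\perp=\mathbf 0$; (ii) $(\bar{\mathbf x}_{\rm avg},\bar{\mathbf\Lambda})$ is a stationary point of $\phi$. That is, $\bar{\mathbf x}_{\rm avg}\in\mathrm{dom}(g)$, $P$ is finite and differentiable relative to $\mathrm{dom}(g)\times\mathbb R^{m\times n_2}$ at $(\bar{\mathbf x}_{\rm avg},\bar{\mathbf\Lambda})$, and with its gradient there, for some $\eta>0$, $$\bar{\mathbf x}_{\rm avg}=\mathrm{prox}_{\eta g}\big(\bar{\mathbf x}_{\rm avg}-\eta\nabla_{\mathbf x}P(\bar{\mathbf x}_{\rm avg},\bar{\mathbf\Lambda})\big),\qquad\nabla_{\mathbf\Lambda}P(\bar{\mathbf x}_{\rm avg},\bar{\mathbf\Lambda})=\mathbf 0 .$$ -/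

import Mathlib

open Filter Topology

noncomputable section

namespace DecMinimax

/-- Column vectors with the Euclidean norm. -/
abbrev Vec (n : ℕ) : Type := EuclideanSpace ℝ (Fin n)

/-- Real `m × n` matrices, given by their `m` rows; the inner product is the Frobenius one. -/
abbrev RowMat (m n : ℕ) : Type := PiLp 2 (fun _ : Fin m => Vec n)

/-! ### Extended-valued convex functions -/

section Convex

variable {E : Type*} [NormedAddCommGroup E] [InnerProductSpace ℝ E]

/-- The effective domain of an extended-valued function. -/
def effDom (r : E → EReal) : Set E := {x | r x < ⊤}

/-- Closed (i.e. lower semicontinuous) proper convex functions `E → (-∞, +∞]`; convexity is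
convexity of the epigraph. -/
structure IsClosedConvex (r : E → EReal) : Prop where
  ne_bot : ∀ x, r x ≠ ⊥
  nonempty_dom : (effDom r).Nonempty
  convex_epigraph : Convex ℝ {q : E × ℝ | r q.1 ≤ (q.2 : EReal)}
  lsc : LowerSemicontinuous r

/-- `z = prox_r(x)`, i.e. `z` minimizes `u ↦ r(u) + ½‖u - x‖²`. -/
def IsProx (r : E → EReal) (x z : E) : Prop :=
  ∀ u, r z + ((1 / 2 * ‖z - x‖ ^ 2 : ℝ) : EReal) ≤ r u + ((1 / 2 * ‖u - x‖ ^ 2 : ℝ) : EReal)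

/-- The (super)differential `∂d(y)` of a concave extended-valued function `d`. -/
def superdiff (d : E → EReal) (y : E) : Set E :=
  {ξ | ∀ u, d u ≤ d y + ((inner ℝ ξ (u - y) : ℝ) : EReal)}

/-- The extended-valued function `F` is finite on `s` near `u ∈ s`, and has the gradient `G` at
`u` relative to `s`. -/
def HasGradOn [CompleteSpace E] (F : E → EReal) (G : E) (s : Set E) (u : E) : Prop :=
  u ∈ s ∧ ∃ F' : E → ℝ, (∀ᶠ v in 𝓝[s] u, F v = (F' v : EReal)) ∧ HasGradientWithinAt F' G s u

end Convex

/-! ### Row matrices -/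

section RowMat

variable {m n : ℕ}

/-- The product `A Y`. -/
def matMul (A : Matrix (Fin m) (Fin m) ℝ) (Y : RowMat m n) : RowMat m n :=
  WithLp.toLp 2 (fun i => ∑ j, A i j • Y j)

/-- The matrix `𝟏 xᵀ`, all of whose rows are `x`. -/
def rep (m : ℕ) (x : Vec n) : RowMat m n := WithLp.toLp 2 (fun _ => x)

/-- `x_avg`, the average of the rows. -/
def avg (X : RowMat m n) : Vec n := (1 / (m : ℝ)) • ∑ i, X i

/-- `X_⊥ = X - 𝟏 x_avgᵀ`. -/
def perp (X : RowMat m n) : RowMat m n := X - rep m (avg X)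

/-- The spectral norm `‖A‖₂`. -/
def specNorm (A : Matrix (Fin m) (Fin m) ℝ) : ℝ := ‖Matrix.toEuclideanCLM (𝕜 := ℝ) A‖

end RowMat

/-! ### The problem -/

/-- The data of the decentralized problem
`min_x max_y (1/m) ∑ᵢ fᵢ(x, y) + g(x) - h(y)`: the functions, the constants `L` and `μ`, and the
mixing matrix `W`. The values of `f i` matter only on an open set specified later. -/
structure Problem (m n₁ n₂ : ℕ) where
  f : Fin m → WithLp 2 (Vec n₁ × Vec n₂) → ℝ
  g : Vec n₁ → EReal
  h : Vec n₂ → EReal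
  L : ℝ
  μ : ℝ
  W : Matrix (Fin m) (Fin m) ℝ

namespace Problem

variable {m n₁ n₂ : ℕ} (D : Problem m n₁ n₂)

/-- The partial gradient `∇ₓ fᵢ(x, y)`. -/
def gradX (i : Fin m) (x : Vec n₁) (y : Vec n₂) : Vec n₁ :=
  gradient (fun x' => D.f i (WithLp.toLp 2 (x', y))) x

/-- The partial gradient `∇_y fᵢ(x, y)`. -/
def gradY (i : Fin m) (x : Vec n₁) (y : Vec n₂) : Vec n₂ :=
  gradient (fun y' => D.f i (WithLp.toLp 2 (x, y'))) y

/-- `p(x) = max_y { (1/m) ∑ᵢ fᵢ(x, y) - h(y) }`. -/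
def p (x : Vec n₁) : EReal :=
  ⨆ y : Vec n₂, ((1 / (m : ℝ) * ∑ i, D.f i (WithLp.toLp 2 (x, y)) : ℝ) : EReal) - D.h y

/-- `Φ(X, Λ, Y) = (1/m) ∑ᵢ (fᵢ(xᵢ, yᵢ) - h(yᵢ)) - L/(2√m) ⟨Λ, (W - I) Y⟩`. -/
def Phi (X : RowMat m n₁) (Λ Y : RowMat m n₂) : EReal :=
  ((1 / (m : ℝ) : ℝ) : EReal) *
      ∑ i, (((D.f i (WithLp.toLp 2 (X i, Y i)) : ℝ) : EReal) - D.h (Y i))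
    - ((D.L / (2 * √(m : ℝ)) * inner ℝ Λ (matMul (D.W - 1) Y) : ℝ) : EReal)

/-- `P(x, Λ) = max_Y Φ(𝟏 xᵀ, Λ, Y)`. -/
def P (x : Vec n₁) (Λ : RowMat m n₂) : EReal := ⨆ Y : RowMat m n₂, D.Phi (rep m x) Λ Y

/-- The condition number `κ = L / μ`. -/
def kappa : ℝ := D.L / D.μ

/-- `ρ = ‖W - (1/m) 𝟏𝟏ᵀ‖₂`. -/
def rho : ℝ := specNorm (D.W - Matrix.of fun _ _ => 1 / (m : ℝ))

/-- Existence of a finite solution, `L`-smoothness and strong concavity. -/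
structure FunAssumption : Prop where
  L_pos : 0 < D.L
  μ_pos : 0 < D.μ
  g_convex : IsClosedConvex D.g
  h_convex : IsClosedConvex D.h
  solution : ∃ x : Vec n₁, (∃ r : ℝ, D.p x + D.g x = (r : EReal)) ∧
    ∀ x', D.p x + D.g x ≤ D.p x' + D.g x'
  smooth : ∃ Z : Set (WithLp 2 (Vec n₁ × Vec n₂)), IsOpen Z ∧
    (∀ x ∈ effDom D.g, ∀ y ∈ effDom D.h, WithLp.toLp 2 (x, y) ∈ Z) ∧
    ∀ i, DifferentiableOn ℝ (D.f i) Z ∧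
      ∀ z ∈ Z, ∀ z' ∈ Z, ‖gradient (D.f i) z - gradient (D.f i) z'‖ ≤ D.L * ‖z - z'‖
  strongly_concave : ∀ i, ∀ x ∈ effDom D.g, ∀ y ∈ effDom D.h, ∀ y' ∈ effDom D.h,
    inner ℝ (y - y') (D.gradY i x y - D.gradY i x y') ≤ -D.μ * ‖y - y'‖ ^ 2

/-- The relative interior of `dom h` is nonempty. -/
def RelintAssumption : Prop := (intrinsicInterior ℝ (effDom D.h)).Nonempty

/-- The conditions on the mixing matrix for the communication graph `𝒢` (every agent may use its
own data). -/
structure MixingAssumption (𝒢 : SimpleGraph (Fin m)) : Prop where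
  support : ∀ i j, i ≠ j → ¬ 𝒢.Adj i j → D.W i j = 0
  rho_lt_one : D.rho < 1
  null_space : LinearMap.ker (Matrix.toLin' (D.W - 1)) = Submodule.span ℝ {fun _ => (1 : ℝ)}
  column_sum : Matrix.mulVec D.W.transpose (fun _ => (1 : ℝ)) = fun _ => 1
  norm_le_two : specNorm (D.W - 1) ≤ 2

/-! ### The algorithm -/

/-- `dᵢ(y) = fᵢ(xᵢ, y) - h(y) - (L√m/2) ⟨λ̃ᵢ, y⟩`, where `λ̃ᵢ = ∑ⱼ wⱼᵢ λⱼ - λᵢ` is the `i`-th row of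
`(W - I)ᵀ Λ`. -/
def dLoc (X : RowMat m n₁) (Λ : RowMat m n₂) (i : Fin m) (y : Vec n₂) : EReal :=
  ((D.f i (WithLp.toLp 2 (X i, y)) : ℝ) : EReal) - D.h y
    - ((D.L * √(m : ℝ) / 2 * inner ℝ ((∑ j, D.W j i • Λ j) - Λ i) y : ℝ) : EReal)

/-- The sequences `X, Λ, Y, V` are generated by D-GDMax with stepsizes `ηx`, `ηlam` and tolerances
`δ`. As the extended distance to the empty set is `⊤`, the conditions on `Y` include that the
superdifferentials are nonempty. -/
structure IsDGDMax (ηx ηlam : ℝ) (δ : ℕ → ℝ)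
    (X : ℕ → RowMat m n₁) (Λ Y : ℕ → RowMat m n₂) (V : ℕ → RowMat m n₁) : Prop where
  tol_nonneg : ∀ t, 0 ≤ δ t
  init_x : ∃ x₀ ∈ effDom D.g, ∀ i, X 0 i = x₀
  init_lam : ∀ i, Λ 0 i = 0
  init_v : ∀ i, V 0 i = D.gradX i (X 0 i) (Y 0 i)
  step_x : ∀ t i, IsProx (fun u => (ηx : EReal) * D.g u)
    ((∑ j, D.W i j • X t j) - ηx • V t i) (X (t + 1) i)
  step_lam : ∀ t i, Λ (t + 1) i =
    Λ t i + (D.L * ηlam / (2 * √(m : ℝ))) • ((∑ j, D.W i j • Y t j) - Y t i)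
  approx_y : ∀ t i, Metric.infEDist 0 (superdiff (D.dLoc (X t) (Λ t) i) (Y t i)) ≤
    ENNReal.ofReal (δ t)
  step_v : ∀ t i, V (t + 1) i = (∑ j, D.W i j • V t j) +
    D.gradX i (X (t + 1) i) (Y (t + 1) i) - D.gradX i (X t i) (Y t i)

/-- The stepsize `η_x = (1-ρ)² / (5 L √(1 + 6κ²))`. -/
def etaX : ℝ := (1 - D.rho) ^ 2 / (5 * D.L * √(1 + 6 * D.kappa ^ 2))

/-- The stepsize `η_λ = (1-ρ)² / (L (9κ + 2))`. -/
def etaLam : ℝ := (1 - D.rho) ^ 2 / (D.L * (9 * D.kappa + 2))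

/-- `(x, Λ)` is a stationary point of `φ = P + g`: for some `η > 0`,
`x = prox_{ηg}(x - η ∇ₓP(x, Λ))` and `∇_ΛP(x, Λ) = 0`. As the functions `fᵢ` are only controlled
over `dom g × dom h`, the gradient `G = (∇ₓP, ∇_ΛP)` is the one relative to `dom g × ℝ^{m×n₂}`. -/
def IsStationary (x : Vec n₁) (Λ : RowMat m n₂) : Prop :=
  ∃ G : WithLp 2 (Vec n₁ × RowMat m n₂),
    HasGradOn (fun u : WithLp 2 (Vec n₁ × RowMat m n₂) => D.P u.fst u.snd) G
      {u | u.fst ∈ effDom D.g} (WithLp.toLp 2 (x, Λ)) ∧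
    (∃ η : ℝ, 0 < η ∧ IsProx (fun u => (η : EReal) * D.g u) (x - η • G.fst) x) ∧
    G.snd = 0

end Problem

end DecMinimax

end

open DecMinimax

/-! The term `⟨Λ, (W - I) Y⟩` prices the disagreement of the copies of `y`. For fixed `(x, Λ)` it is
a sum over rows, so maximizing `Φ(𝟏xᵀ, Λ, ·)` splits into `m` strongly concave local problems.
Adding two optimality conditions shows that their solutions `S x Λ` are Lipschitz in `(x, Λ)`
(`IsOptimalAt.norm_sub_le`). Hence `P` differs from its linearization, with the envelope-theorem
gradient, by at most a quadratic (`IsResponse.le_phiReal`, `IsResponse.phiReal_le`), so it is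
differentiable relative to `dom g × ℝ^{m×n₂}`.

The method is a perturbed proximal gradient method for `P + g`. The `Λ`-update is a gradient step
with `Y` in place of the exact maximizers. The average of the trackers `V` equals the average of the
local gradients, because the columns of `W` sum to one (`IsDGDMax.avg_V`). The perturbations are the
disagreements of `X` and `V` and the inexactness of `Y`. Mixing contracts disagreement by the factor
`ρ`, and the proximal map does not enlarge it.

The Lyapunov function is `(P + g)/L` at the average plus weighted squared disagreements. With the
given stepsizes, each step lowers it by a positive combination of the squared increments of `avg X`
and `Λ` and the squared disagreements, up to a summable error (`lyapunov_step`, `lyapunov_le`). It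
is bounded below because `P ≥ p` and `p + g` has a finite minimum. So all these quantities tend to
zero (`IsDGDMax.tendsto_zero`).

Along a subsequence converging to a limit point, the rows of `X` have a common limit, the rows of
`V` tend to a value of the continuous extension of `∇ₓP`, and `Y` tends to the exact maximizers.
Since the graph of the proximal map is closed, the proximal equation survives; `∇_ΛP = 0` follows
from the vanishing increments of `Λ`. -/

open Filter Topology

noncomputable section

namespace DecMinimax

/-! ### Row matrices: averages, disagreement and mixing. -/

section RowMat

variable {m n : ℕ}

@[simp]
theorem matMul_apply (A : Matrix (Fin m) (Fin m) ℝ) (Y : RowMat m n) (i : Fin m) :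
    matMul A Y i = ∑ j, A i j • Y j := rfl

@[simp]
theorem rep_apply (x : Vec n) (i : Fin m) : rep m x i = x := rfl

theorem perp_apply (X : RowMat m n) (i : Fin m) : perp X i = X i - avg X := rfl

theorem matMul_sub (A : Matrix (Fin m) (Fin m) ℝ) (Y Z : RowMat m n) :
    matMul A (Y - Z) = matMul A Y - matMul A Z := by
  ext i : 1
  simp [smul_sub, Finset.sum_sub_distrib]

theorem matMul_sub_one_apply (A : Matrix (Fin m) (Fin m) ℝ) (Y : RowMat m n) (i : Fin m) :
    matMul (A - 1) Y i = (∑ j, A i j • Y j) - Y i := by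
  simp [sub_smul, Finset.sum_sub_distrib, Matrix.one_apply]

theorem rowMat_inner (X Y : RowMat m n) : inner ℝ X Y = ∑ i, inner ℝ (X i) (Y i) := rfl

theorem rowMat_norm_sq (X : RowMat m n) : ‖X‖ ^ 2 = ∑ i, ‖X i‖ ^ 2 :=
  PiLp.norm_sq_eq_of_L2 _ X

theorem rowMat_norm_sq_entries (X : RowMat m n) : ‖X‖ ^ 2 = ∑ k, ∑ i, X i k ^ 2 := by
  rw [rowMat_norm_sq, Finset.sum_comm]
  simp [EuclideanSpace.norm_sq_eq]

theorem inner_matMul (A : Matrix (Fin m) (Fin m) ℝ) (X Y : RowMat m n) :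
    inner ℝ X (matMul A Y) = inner ℝ (matMul A.transpose X) Y := by
  simp only [rowMat_inner, matMul_apply, inner_sum, sum_inner, inner_smul_left, inner_smul_right,
    Matrix.transpose_apply, conj_trivial]
  exact Finset.sum_comm

theorem specNorm_nonneg (A : Matrix (Fin m) (Fin m) ℝ) : 0 ≤ specNorm A := norm_nonneg _

/-- The squared Frobenius norm is a sum over columns, and `A` acts on each column separately. -/
theorem norm_matMul_le (A : Matrix (Fin m) (Fin m) ℝ) (Y : RowMat m n) :
    ‖matMul A Y‖ ≤ specNorm A * ‖Y‖ := by
  refine le_of_sq_le_sq ?_ (mul_nonneg (specNorm_nonneg A) (norm_nonneg _))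
  rw [mul_pow, rowMat_norm_sq_entries, rowMat_norm_sq_entries, Finset.mul_sum]
  refine Finset.sum_le_sum fun k _ => ?_
  have h := (Matrix.toEuclideanCLM (𝕜 := ℝ) A).le_opNorm
    (WithLp.toLp 2 fun i => Y i k)
  have h2 := pow_le_pow_left₀ (norm_nonneg _) h 2
  rw [mul_pow, EuclideanSpace.norm_sq_eq, EuclideanSpace.norm_sq_eq] at h2
  simpa [specNorm, Matrix.toLpLin_apply, Matrix.mulVec, dotProduct] using h2

theorem norm_matMul_transpose_le (A : Matrix (Fin m) (Fin m) ℝ) (Y : RowMat m n) :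
    ‖matMul A.transpose Y‖ ≤ specNorm A * ‖Y‖ := by
  have h : ‖matMul A.transpose Y‖ ^ 2 ≤ ‖matMul A.transpose Y‖ * (specNorm A * ‖Y‖) := by
    rw [← real_inner_self_eq_norm_sq, ← inner_matMul]
    refine (real_inner_le_norm _ _).trans ?_
    have := mul_le_mul_of_nonneg_left (norm_matMul_le A (matMul A.transpose Y)) (norm_nonneg Y)
    linarith
  rcases (norm_nonneg (matMul A.transpose Y)).eq_or_lt with h0 | h0
  · rw [← h0]
    exact mul_nonneg (specNorm_nonneg A) (norm_nonneg _)
  · rw [sq] at h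
    exact le_of_mul_le_mul_left h h0

theorem rep_add (x y : Vec n) : rep m (x + y) = rep m x + rep m y := rfl

theorem rep_sub (x y : Vec n) : rep m (x - y) = rep m x - rep m y := rfl

theorem avg_sub (X Y : RowMat m n) : avg (X - Y) = avg X - avg Y := by
  simp [avg, Finset.sum_sub_distrib, smul_sub]

theorem avg_add (X Y : RowMat m n) : avg (X + Y) = avg X + avg Y := by
  simp [avg, Finset.sum_add_distrib, smul_add]

theorem avg_smul (c : ℝ) (X : RowMat m n) : avg (c • X) = c • avg X := by
  simp only [avg, PiLp.smul_apply, ← Finset.smul_sum]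
  rw [smul_comm]

theorem perp_sub (X Y : RowMat m n) : perp (X - Y) = perp X - perp Y := by
  simp only [perp, avg_sub, rep_sub]
  abel

theorem perp_add (X Y : RowMat m n) : perp (X + Y) = perp X + perp Y := by
  simp only [perp, avg_add, rep_add]
  abel

theorem perp_smul (c : ℝ) (X : RowMat m n) : perp (c • X) = c • perp X := by
  simp only [perp, avg_smul, smul_sub]
  rfl

theorem continuous_avg : Continuous (avg : RowMat m n → Vec n) := by
  unfold avg
  fun_prop

theorem continuous_perp : Continuous (perp : RowMat m n → RowMat m n) := by
  have : Continuous (rep m : Vec n → RowMat m n) := by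
    unfold rep
    fun_prop
  exact continuous_id.sub (this.comp continuous_avg)

theorem sum_eq_smul_avg (hm : 0 < m) (X : RowMat m n) : ∑ i, X i = (m : ℝ) • avg X := by
  have : (m : ℝ) ≠ 0 := by positivity
  simp [avg, smul_smul, this]

theorem avg_rep (hm : 0 < m) (x : Vec n) : avg (rep m x) = x := by
  have : (m : ℝ) ≠ 0 := by positivity
  simp [avg, ← Nat.cast_smul_eq_nsmul ℝ, smul_smul, this]

theorem perp_rep (hm : 0 < m) (x : Vec n) : perp (rep m x) = 0 := by
  simp [perp, avg_rep hm]

theorem avg_perp (hm : 0 < m) (X : RowMat m n) : avg (perp X) = 0 := by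
  simp [perp, avg_sub, avg_rep hm]

theorem rep_avg_add_perp (X : RowMat m n) : rep m (avg X) + perp X = X := by
  simp [perp]

theorem inner_rep (hm : 0 < m) (x : Vec n) (Y : RowMat m n) :
    inner ℝ (rep m x) Y = (m : ℝ) * inner ℝ x (avg Y) := by
  simp only [rowMat_inner, rep_apply]
  rw [← inner_sum, sum_eq_smul_avg hm, inner_smul_right]

theorem inner_perp_perp (hm : 0 < m) (X Y : RowMat m n) :
    inner ℝ X (perp Y) = inner ℝ (perp X) (perp Y) := by
  conv_lhs => rw [← rep_avg_add_perp X]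
  rw [inner_add_left, inner_rep hm, avg_perp hm]
  simp

theorem inner_eq_avg_add_perp (hm : 0 < m) (X Y : RowMat m n) :
    inner ℝ X Y = (m : ℝ) * inner ℝ (avg X) (avg Y) + inner ℝ (perp X) (perp Y) := by
  rw [← inner_perp_perp hm]
  conv_lhs => rw [← rep_avg_add_perp Y]
  rw [inner_add_right, real_inner_comm, inner_rep hm, real_inner_comm]

theorem norm_sq_eq_avg_add_perp (hm : 0 < m) (X : RowMat m n) :
    ‖X‖ ^ 2 = (m : ℝ) * ‖avg X‖ ^ 2 + ‖perp X‖ ^ 2 := by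
  simp only [← real_inner_self_eq_norm_sq]
  exact inner_eq_avg_add_perp hm X X

theorem norm_perp_le (hm : 0 < m) (X : RowMat m n) : ‖perp X‖ ≤ ‖X‖ := by
  refine le_of_sq_le_sq ?_ (norm_nonneg _)
  rw [norm_sq_eq_avg_add_perp hm X]
  have : 0 ≤ (m : ℝ) * ‖avg X‖ ^ 2 := by positivity
  linarith

theorem norm_avg_sq_le (hm : 0 < m) (X : RowMat m n) : (m : ℝ) * ‖avg X‖ ^ 2 ≤ ‖X‖ ^ 2 := by
  rw [norm_sq_eq_avg_add_perp hm X]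
  have : 0 ≤ ‖perp X‖ ^ 2 := by positivity
  linarith

theorem avg_matMul {W : Matrix (Fin m) (Fin m) ℝ}
    (hcol : Matrix.mulVec W.transpose (fun _ => (1 : ℝ)) = fun _ => 1) (X : RowMat m n) :
    avg (matMul W X) = avg X := by
  have h : ∀ j, ∑ i, W i j = 1 := fun j => by
    simpa [Matrix.mulVec, dotProduct] using congrFun hcol j
  simp only [avg, matMul_apply]
  rw [Finset.sum_comm]
  simp [← Finset.sum_smul, h]

theorem matMul_rep {W : Matrix (Fin m) (Fin m) ℝ} (hrow : ∀ i, ∑ j, W i j = 1) (x : Vec n) :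
    matMul W (rep m x) = rep m x := by
  ext i : 1
  simp [← Finset.sum_smul, hrow]

theorem matMul_sub_average (W : Matrix (Fin m) (Fin m) ℝ) (X : RowMat m n) :
    matMul (W - Matrix.of fun _ _ => 1 / (m : ℝ)) X = matMul W X - rep m (avg X) := by
  ext i : 1
  simp [sub_smul, Finset.sum_sub_distrib, avg, Finset.smul_sum]

/-- Unit column sums make `W` preserve averages, and unit row sums make it fix consensus matrices.
Disagreement therefore evolves under `W - 𝟏𝟏ᵀ/m` alone, whose norm is `ρ`. -/
theorem perp_matMul (hm : 0 < m) {W : Matrix (Fin m) (Fin m) ℝ}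
    (hcol : Matrix.mulVec W.transpose (fun _ => (1 : ℝ)) = fun _ => 1)
    (hrow : ∀ i, ∑ j, W i j = 1) (X : RowMat m n) :
    perp (matMul W X) = matMul (W - Matrix.of fun _ _ => 1 / (m : ℝ)) (perp X) := by
  rw [matMul_sub_average, avg_perp hm, perp, avg_matMul hcol, perp, matMul_sub, matMul_rep hrow]
  simp only [sub_right_inj, sub_sub]
  exact (add_zero _).symm

theorem norm_perp_matMul_le (hm : 0 < m) {W : Matrix (Fin m) (Fin m) ℝ}
    (hcol : Matrix.mulVec W.transpose (fun _ => (1 : ℝ)) = fun _ => 1)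
    (hrow : ∀ i, ∑ j, W i j = 1) (X : RowMat m n) :
    ‖perp (matMul W X)‖ ≤ specNorm (W - Matrix.of fun _ _ => 1 / (m : ℝ)) * ‖perp X‖ := by
  rw [perp_matMul hm hcol hrow]
  exact norm_matMul_le _ _

end RowMat

/-! ### Closed convex functions and proximal points. -/

/-- Divide by `t` and let `t → 0`. This turns comparisons along a segment into first-order
conditions. -/
theorem le_of_forall_le_add_mul {a b c : ℝ} (h : ∀ t ∈ Set.Ioc (0 : ℝ) 1, t * a ≤ t * b + t ^ 2 * c) :
    a ≤ b := by
  have h1 : ∀ᶠ t in 𝓝[>] (0 : ℝ), a ≤ b + t * c := by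
    filter_upwards [Ioc_mem_nhdsGT (zero_lt_one' ℝ)] with t ht
    have := h t ht
    have ht0 := ht.1
    refine le_of_mul_le_mul_left (a := t) ?_ ht0
    linarith
  have h2 : Tendsto (fun t : ℝ => b + t * c) (𝓝[>] 0) (𝓝 (b + 0 * c)) :=
    ((continuous_const.add (continuous_id.mul continuous_const)).tendsto 0).mono_left
      nhdsWithin_le_nhds
  simpa using ge_of_tendsto h2 h1

section Convex

variable {E : Type*} [NormedAddCommGroup E] [InnerProductSpace ℝ E] {r : E → EReal}

theorem IsClosedConvex.coe_toReal (hr : IsClosedConvex r) {x : E} (hx : x ∈ effDom r) :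
    ((r x).toReal : EReal) = r x :=
  EReal.coe_toReal (ne_of_lt hx) (hr.ne_bot x)

theorem eq_top_of_notMem_effDom {E : Type*} {r : E → EReal} {x : E} (hx : x ∉ effDom r) : r x = ⊤ := by
  simpa [effDom] using hx

theorem IsClosedConvex.convexOn (hr : IsClosedConvex r) :
    ConvexOn ℝ (effDom r) fun x => (r x).toReal := by
  have key : ∀ x ∈ effDom r, ∀ y ∈ effDom r, ∀ a b : ℝ, 0 ≤ a → 0 ≤ b → a + b = 1 →
      r (a • x + b • y) ≤ ((a * (r x).toReal + b * (r y).toReal : ℝ) : EReal) := by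
    intro x hx y hy a b ha hb hab
    have := hr.convex_epigraph (x := (x, (r x).toReal)) (y := (y, (r y).toReal))
      (by simp [hr.coe_toReal hx]) (by simp [hr.coe_toReal hy]) ha hb hab
    simpa using this
  refine ⟨fun x hx y hy a b ha hb hab => ?_, fun x hx y hy a b ha hb hab => ?_⟩
  · exact (key x hx y hy a b ha hb hab).trans_lt (EReal.coe_lt_top _)
  · have h := key x hx y hy a b ha hb hab
    have hm : a • x + b • y ∈ effDom r := h.trans_lt (EReal.coe_lt_top _)
    rw [← hr.coe_toReal hm, EReal.coe_le_coe_iff] at h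
    simpa using h

theorem IsClosedConvex.convex_effDom (hr : IsClosedConvex r) : Convex ℝ (effDom r) :=
  hr.convexOn.1

theorem IsClosedConvex.toReal_segment_le (hr : IsClosedConvex r) {x y : E} (hx : x ∈ effDom r)
    (hy : y ∈ effDom r) {t : ℝ} (ht : t ∈ Set.Icc (0 : ℝ) 1) :
    x + t • (y - x) ∈ effDom r ∧
      (r (x + t • (y - x))).toReal ≤ (r x).toReal + t * ((r y).toReal - (r x).toReal) := by
  have e : x + t • (y - x) = (1 - t) • x + t • y := by module
  rw [e]
  refine ⟨hr.convex_effDom hx hy (sub_nonneg.2 ht.2) ht.1 (by ring), ?_⟩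
  have h := hr.convexOn.2
  have := @h _ hx _ hy (1 - t) t (sub_nonneg.2 ht.2) ht.1 (by ring)
  simp only [smul_eq_mul] at this
  linarith

theorem IsClosedConvex.coe_mul_eq (hr : IsClosedConvex r) (η : ℝ) {u : E} (hu : u ∈ effDom r) :
    (η : EReal) * r u = ((η * (r u).toReal : ℝ) : EReal) := by
  rw [EReal.coe_mul, hr.coe_toReal hu]

theorem IsClosedConvex.mem_effDom_of_isProx (hr : IsClosedConvex r) {η : ℝ} (hη : 0 < η) {x z : E}
    (h : IsProx (fun u => (η : EReal) * r u) x z) : z ∈ effDom r := by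
  obtain ⟨u, hu⟩ := hr.nonempty_dom
  by_contra hz
  have h1 := h u
  simp only [eq_top_of_notMem_effDom hz, EReal.coe_mul_top_of_pos hη, EReal.top_add_coe,
    hr.coe_mul_eq η hu, ← EReal.coe_add] at h1
  exact EReal.coe_ne_top _ (top_le_iff.1 h1)

theorem IsClosedConvex.isProx_iff (hr : IsClosedConvex r) {η : ℝ} (hη : 0 < η) {x z : E}
    (hz : z ∈ effDom r) : IsProx (fun u => (η : EReal) * r u) x z ↔
      ∀ u ∈ effDom r, η * (r z).toReal + 1 / 2 * ‖z - x‖ ^ 2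
        ≤ η * (r u).toReal + 1 / 2 * ‖u - x‖ ^ 2 := by
  refine ⟨fun h u hu => ?_, fun h u => ?_⟩
  · have := h u
    simp only [hr.coe_mul_eq η hu, hr.coe_mul_eq η hz, ← EReal.coe_add, EReal.coe_le_coe_iff]
      at this
    exact this
  · by_cases hu : u ∈ effDom r
    · simp only [hr.coe_mul_eq η hu, hr.coe_mul_eq η hz, ← EReal.coe_add, EReal.coe_le_coe_iff]
      exact h u hu
    · simp only [eq_top_of_notMem_effDom hu, EReal.coe_mul_top_of_pos hη, EReal.top_add_coe]
      exact le_top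

/-- Compare `z` with `z + t (u - z)`: convexity bounds `r` there, and the quadratic term contributes
only at order `t²`. -/
theorem IsClosedConvex.isProx_variational (hr : IsClosedConvex r) {η : ℝ} (hη : 0 < η) {x z : E}
    (h : IsProx (fun u => (η : EReal) * r u) x z) {u : E} (hu : u ∈ effDom r) :
    η * (r z).toReal + inner ℝ (x - z) (u - z) ≤ η * (r u).toReal := by
  have hz := hr.mem_effDom_of_isProx hη h
  rw [hr.isProx_iff hη hz] at h
  refine le_of_forall_le_add_mul (c := 1 / 2 * ‖u - z‖ ^ 2) fun t ht => ?_
  obtain ⟨hm, hle⟩ := hr.toReal_segment_le hz hu ⟨ht.1.le, ht.2⟩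
  have h1 := h _ hm
  have e : z + t • (u - z) - x = (z - x) + t • (u - z) := by abel
  rw [e, norm_add_sq_real, norm_smul, inner_smul_right, mul_pow, Real.norm_eq_abs, sq_abs] at h1
  have e2 : inner ℝ (x - z) (u - z) = - inner ℝ (z - x) (u - z) := by
    rw [← inner_neg_left, neg_sub]
  rw [e2]
  have := mul_le_mul_of_nonneg_left hle hη.le
  linarith

/-- The graph of the proximal map is closed. The domain of `r` need not be closed, so membership of
`z₀` is part of what is proved: the proximal inequality bounds `r (z k)` from above, and lower
semicontinuity carries the bound to `r z₀`. -/
theorem IsClosedConvex.isProx_of_tendsto (hr : IsClosedConvex r) {η : ℝ} (hη : 0 < η)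
    {ι : Type*} {l : Filter ι} [l.NeBot] {x z : ι → E} {x₀ z₀ : E} (hx : Tendsto x l (𝓝 x₀))
    (hz : Tendsto z l (𝓝 z₀)) (h : ∀ k, IsProx (fun u => (η : EReal) * r u) (x k) (z k)) :
    IsProx (fun u => (η : EReal) * r u) x₀ z₀ := by
  have hzk := fun k => hr.mem_effDom_of_isProx hη (h k)
  have key : ∀ u ∈ effDom r, r z₀ ≤
      (((η * (r u).toReal + 1 / 2 * ‖u - x₀‖ ^ 2 - 1 / 2 * ‖z₀ - x₀‖ ^ 2) / η : ℝ) : EReal) := by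
    intro u hu
    -- A real `c` strictly between the two sides is eventually below `r (z k)` by semicontinuity,
    -- and eventually above the bound that the proximal inequality imposes on `r (z k)`.
    by_contra! hlt
    obtain ⟨c, hc1, hc2⟩ := EReal.lt_iff_exists_real_btwn.1 hlt
    have hlim : Tendsto (fun k =>
        (η * (r u).toReal + 1 / 2 * ‖u - x k‖ ^ 2 - 1 / 2 * ‖z k - x k‖ ^ 2) / η) l
        (𝓝 ((η * (r u).toReal + 1 / 2 * ‖u - x₀‖ ^ 2 - 1 / 2 * ‖z₀ - x₀‖ ^ 2) / η)) :=
      (((((tendsto_const_nhds.sub hx).norm.pow 2).const_mul _).const_add _).sub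
        (((hz.sub hx).norm.pow 2).const_mul _)).div_const _
    have h1 := hlim.eventually_lt_const (EReal.coe_lt_coe_iff.1 hc1)
    have h2 := hz.eventually (hr.lsc z₀ _ hc2)
    obtain ⟨k, hk1, hk2⟩ := (h1.and h2).exists
    rw [← hr.coe_toReal (hzk k), gt_iff_lt, EReal.coe_lt_coe_iff] at hk2
    have h3 := (hr.isProx_iff hη (hzk k)).1 (h k) u hu
    rw [div_lt_iff₀ hη] at hk1
    nlinarith
  have hz₀ : z₀ ∈ effDom r := by
    obtain ⟨u, hu⟩ := hr.nonempty_dom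
    exact (key u hu).trans_lt (EReal.coe_lt_top _)
  rw [hr.isProx_iff hη hz₀]
  intro u hu
  have := key u hu
  rw [← hr.coe_toReal hz₀, EReal.coe_le_coe_iff, le_div_iff₀ hη] at this
  linarith

end Convex

/-! ### Local functions: quadratic bounds and local maximizers. -/

/-- Integrates a derivative bound without integrals. The sign of `K` is free: positive for
smoothness, negative for strong concavity. -/
theorem le_of_deriv_le_add_mul {φ φ' : ℝ → ℝ} {K : ℝ}
    (hd : ∀ t ∈ Set.Icc (0 : ℝ) 1, HasDerivAt φ (φ' t) t)
    (hle : ∀ t ∈ Set.Ico (0 : ℝ) 1, φ' t ≤ φ' 0 + K * t) : φ 1 ≤ φ 0 + φ' 0 + K / 2 := by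
  have hB : ∀ t : ℝ, HasDerivAt (fun t => φ 0 + φ' 0 * t + K / 2 * t ^ 2) (φ' 0 + K * t) t := by
    intro t
    have h1 := ((hasDerivAt_id t).const_mul (φ' 0)).const_add (φ 0)
    have h2 := ((hasDerivAt_id t).pow 2).const_mul (K / 2)
    refine (h1.add h2).congr_deriv ?_
    simp
    ring
  have := image_le_of_deriv_right_le_deriv_boundary (f := φ) (f' := φ') (a := 0) (b := 1)
    (fun t ht => (hd t ht).continuousAt.continuousWithinAt)
    (fun t ht => (hd t ⟨ht.1, ht.2.le⟩).hasDerivWithinAt)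
    (B := fun t => φ 0 + φ' 0 * t + K / 2 * t ^ 2) (B' := fun t => φ' 0 + K * t) (by simp)
    (fun t _ => (hB t).continuousAt.continuousWithinAt) (fun t _ => (hB t).hasDerivWithinAt)
    hle (Set.right_mem_Icc.2 zero_le_one)
  simpa using this

namespace Problem

variable {m n₁ n₂ : ℕ} {D : Problem m n₁ n₂}

theorem FunAssumption.hasGradientAt (hfun : D.FunAssumption) (i : Fin m) {x : Vec n₁} {y : Vec n₂}
    (hx : x ∈ effDom D.g) (hy : y ∈ effDom D.h) :
    HasGradientAt (D.f i) (gradient (D.f i) (WithLp.toLp 2 (x, y))) (WithLp.toLp 2 (x, y)) := by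
  obtain ⟨Z, hZ, hsub, hf⟩ := hfun.smooth
  exact ((hf i).1.differentiableAt (hZ.mem_nhds (hsub x hx y hy))).hasGradientAt

theorem FunAssumption.hasGradientAt_fst (hfun : D.FunAssumption) (i : Fin m) {x : Vec n₁}
    {y : Vec n₂} (hx : x ∈ effDom D.g) (hy : y ∈ effDom D.h) :
    HasGradientAt (fun x' => D.f i (WithLp.toLp 2 (x', y)))
      (gradient (D.f i) (WithLp.toLp 2 (x, y))).fst x := by
  have h1 := (hfun.hasGradientAt i hx hy).hasFDerivAt
  have h2 : HasFDerivAt (fun x' : Vec n₁ => (WithLp.toLp 2 (x', y) : WithLp 2 (Vec n₁ × Vec n₂)))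
      ((WithLp.prodContinuousLinearEquiv 2 ℝ (Vec n₁) (Vec n₂)).symm.toContinuousLinearMap.comp
        (ContinuousLinearMap.inl ℝ (Vec n₁) (Vec n₂))) x :=
    (WithLp.prodContinuousLinearEquiv 2 ℝ (Vec n₁) (Vec n₂)).symm.hasFDerivAt.comp x
      (hasFDerivAt_prodMk_left x y)
  have h3 := h1.comp x h2
  rw [hasGradientAt_iff_hasFDerivAt]
  refine h3.congr_fderiv ?_
  generalize gradient (D.f i) (WithLp.toLp 2 (x, y)) = G
  ext v
  simp [WithLp.prod_inner_apply]

theorem FunAssumption.hasGradientAt_snd (hfun : D.FunAssumption) (i : Fin m) {x : Vec n₁}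
    {y : Vec n₂} (hx : x ∈ effDom D.g) (hy : y ∈ effDom D.h) :
    HasGradientAt (fun y' => D.f i (WithLp.toLp 2 (x, y')))
      (gradient (D.f i) (WithLp.toLp 2 (x, y))).snd y := by
  have h1 := (hfun.hasGradientAt i hx hy).hasFDerivAt
  have h2 : HasFDerivAt (fun y' : Vec n₂ => (WithLp.toLp 2 (x, y') : WithLp 2 (Vec n₁ × Vec n₂)))
      ((WithLp.prodContinuousLinearEquiv 2 ℝ (Vec n₁) (Vec n₂)).symm.toContinuousLinearMap.comp
        (ContinuousLinearMap.inr ℝ (Vec n₁) (Vec n₂))) y :=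
    (WithLp.prodContinuousLinearEquiv 2 ℝ (Vec n₁) (Vec n₂)).symm.hasFDerivAt.comp y
      (hasFDerivAt_prodMk_right x y)
  have h3 := h1.comp y h2
  rw [hasGradientAt_iff_hasFDerivAt]
  refine h3.congr_fderiv ?_
  generalize gradient (D.f i) (WithLp.toLp 2 (x, y)) = G
  ext v
  simp [WithLp.prod_inner_apply]

theorem FunAssumption.gradX_eq (hfun : D.FunAssumption) (i : Fin m) {x : Vec n₁}
    {y : Vec n₂} (hx : x ∈ effDom D.g) (hy : y ∈ effDom D.h) :
    D.gradX i x y = (gradient (D.f i) (WithLp.toLp 2 (x, y))).fst :=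
  (hfun.hasGradientAt_fst i hx hy).gradient

theorem FunAssumption.gradY_eq (hfun : D.FunAssumption) (i : Fin m) {x : Vec n₁}
    {y : Vec n₂} (hx : x ∈ effDom D.g) (hy : y ∈ effDom D.h) :
    D.gradY i x y = (gradient (D.f i) (WithLp.toLp 2 (x, y))).snd :=
  (hfun.hasGradientAt_snd i hx hy).gradient

theorem FunAssumption.norm_gradient_sub_sq_le (hfun : D.FunAssumption) (i : Fin m)
    {x x' : Vec n₁} {y y' : Vec n₂} (hx : x ∈ effDom D.g) (hy : y ∈ effDom D.h)
    (hx' : x' ∈ effDom D.g) (hy' : y' ∈ effDom D.h) :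
    ‖D.gradX i x y - D.gradX i x' y'‖ ^ 2 + ‖D.gradY i x y - D.gradY i x' y'‖ ^ 2
      ≤ D.L ^ 2 * (‖x - x'‖ ^ 2 + ‖y - y'‖ ^ 2) := by
  obtain ⟨Z, hZ, hsub, hf⟩ := hfun.smooth
  have h := (hf i).2 _ (hsub x hx y hy) _ (hsub x' hx' y' hy')
  have h2 := pow_le_pow_left₀ (norm_nonneg _) h 2
  rw [mul_pow, WithLp.prod_norm_sq_eq_of_L2, WithLp.prod_norm_sq_eq_of_L2] at h2
  rw [hfun.gradX_eq i hx hy, hfun.gradX_eq i hx' hy', hfun.gradY_eq i hx hy,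
    hfun.gradY_eq i hx' hy']
  simpa using h2

theorem FunAssumption.norm_gradX_sub_sq_le (hfun : D.FunAssumption) (i : Fin m)
    {x x' : Vec n₁} {y y' : Vec n₂} (hx : x ∈ effDom D.g) (hy : y ∈ effDom D.h)
    (hx' : x' ∈ effDom D.g) (hy' : y' ∈ effDom D.h) :
    ‖D.gradX i x y - D.gradX i x' y'‖ ^ 2 ≤ D.L ^ 2 * (‖x - x'‖ ^ 2 + ‖y - y'‖ ^ 2) := by
  have := hfun.norm_gradient_sub_sq_le i hx hy hx' hy'
  have h0 : 0 ≤ ‖D.gradY i x y - D.gradY i x' y'‖ ^ 2 := by positivity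
  linarith

theorem FunAssumption.norm_gradX_sub_le_fst (hfun : D.FunAssumption) (i : Fin m)
    {x x' : Vec n₁} {y : Vec n₂} (hx : x ∈ effDom D.g) (hy : y ∈ effDom D.h)
    (hx' : x' ∈ effDom D.g) :
    ‖D.gradX i x y - D.gradX i x' y‖ ≤ D.L * ‖x - x'‖ := by
  have := hfun.norm_gradX_sub_sq_le i hx hy hx' hy
  have hL := hfun.L_pos
  refine le_of_sq_le_sq ?_ (by positivity)
  simpa [mul_pow] using this

theorem FunAssumption.norm_gradX_sub_le_snd (hfun : D.FunAssumption) (i : Fin m)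
    {x : Vec n₁} {y y' : Vec n₂} (hx : x ∈ effDom D.g) (hy : y ∈ effDom D.h)
    (hy' : y' ∈ effDom D.h) :
    ‖D.gradX i x y - D.gradX i x y'‖ ≤ D.L * ‖y - y'‖ := by
  have := hfun.norm_gradX_sub_sq_le i hx hy hx hy'
  have hL := hfun.L_pos
  refine le_of_sq_le_sq ?_ (by positivity)
  simpa [mul_pow] using this

theorem FunAssumption.norm_gradY_sub_le_fst (hfun : D.FunAssumption) (i : Fin m)
    {x x' : Vec n₁} {y : Vec n₂} (hx : x ∈ effDom D.g) (hy : y ∈ effDom D.h)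
    (hx' : x' ∈ effDom D.g) :
    ‖D.gradY i x y - D.gradY i x' y‖ ≤ D.L * ‖x - x'‖ := by
  have := hfun.norm_gradient_sub_sq_le i hx hy hx' hy
  have hL := hfun.L_pos
  have h0 : 0 ≤ ‖D.gradX i x y - D.gradX i x' y‖ ^ 2 := by positivity
  refine le_of_sq_le_sq ?_ (by positivity)
  simp only [sub_self, norm_zero, mul_pow] at this ⊢
  linarith

theorem FunAssumption.norm_gradY_sub_le_snd (hfun : D.FunAssumption) (i : Fin m)
    {x : Vec n₁} {y y' : Vec n₂} (hx : x ∈ effDom D.g) (hy : y ∈ effDom D.h)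
    (hy' : y' ∈ effDom D.h) :
    ‖D.gradY i x y - D.gradY i x y'‖ ≤ D.L * ‖y - y'‖ := by
  have := hfun.norm_gradient_sub_sq_le i hx hy hx hy'
  have hL := hfun.L_pos
  have h0 : 0 ≤ ‖D.gradX i x y - D.gradX i x y'‖ ^ 2 := by positivity
  refine le_of_sq_le_sq ?_ (by positivity)
  simp only [sub_self, norm_zero, mul_pow] at this ⊢
  linarith

theorem FunAssumption.hasDerivAt_fst (hfun : D.FunAssumption) (i : Fin m) {x d : Vec n₁}
    {y : Vec n₂} {t : ℝ} (hx : x + t • d ∈ effDom D.g) (hy : y ∈ effDom D.h) :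
    HasDerivAt (fun t : ℝ => D.f i (WithLp.toLp 2 (x + t • d, y)))
      (inner ℝ (D.gradX i (x + t • d) y) d) t := by
  have h1 := (hfun.hasGradientAt_fst i hx hy).hasFDerivAt
  have h2 : HasDerivAt (fun t : ℝ => x + t • d) d t := by
    simpa using ((hasDerivAt_id t).smul_const d).const_add x
  rw [hfun.gradX_eq i hx hy]
  exact h1.comp_hasDerivAt t h2

theorem FunAssumption.hasDerivAt_snd (hfun : D.FunAssumption) (i : Fin m) {x : Vec n₁}
    {y d : Vec n₂} {t : ℝ} (hx : x ∈ effDom D.g) (hy : y + t • d ∈ effDom D.h) :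
    HasDerivAt (fun t : ℝ => D.f i (WithLp.toLp 2 (x, y + t • d)))
      (inner ℝ (D.gradY i x (y + t • d)) d) t := by
  have h1 := (hfun.hasGradientAt_snd i hx hy).hasFDerivAt
  have h2 : HasDerivAt (fun t : ℝ => y + t • d) d t := by
    simpa using ((hasDerivAt_id t).smul_const d).const_add y
  rw [hfun.gradY_eq i hx hy]
  exact h1.comp_hasDerivAt t h2

/-- Quadratic upper and lower bounds for `fᵢ(·, y)`. -/
theorem FunAssumption.abs_sub_le_fst (hfun : D.FunAssumption) (i : Fin m) {x x' : Vec n₁}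
    {y : Vec n₂} (hx : x ∈ effDom D.g) (hx' : x' ∈ effDom D.g) (hy : y ∈ effDom D.h) :
    |D.f i (WithLp.toLp 2 (x', y)) - D.f i (WithLp.toLp 2 (x, y))
      - inner ℝ (D.gradX i x y) (x' - x)| ≤ D.L / 2 * ‖x' - x‖ ^ 2 := by
  have hseg : ∀ t ∈ Set.Icc (0 : ℝ) 1, x + t • (x' - x) ∈ effDom D.g := fun t ht =>
    (hfun.g_convex.toReal_segment_le hx hx' ht).1
  have hd : ∀ t ∈ Set.Icc (0 : ℝ) 1, HasDerivAt
      (fun t : ℝ => D.f i (WithLp.toLp 2 (x + t • (x' - x), y)))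
      (inner ℝ (D.gradX i (x + t • (x' - x)) y) (x' - x)) t :=
    fun t ht => hfun.hasDerivAt_fst i (hseg t ht) hy
  have hb : ∀ t ∈ Set.Icc (0 : ℝ) 1, |inner ℝ (D.gradX i (x + t • (x' - x)) y) (x' - x)
      - inner ℝ (D.gradX i (x + (0 : ℝ) • (x' - x)) y) (x' - x)| ≤ D.L * ‖x' - x‖ ^ 2 * t := by
    intro t ht
    rw [← inner_sub_left]
    refine (abs_real_inner_le_norm _ _).trans ?_
    have h1 := hfun.norm_gradX_sub_le_fst i (hseg t ht) hy (hseg 0 (by simp))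
    have e : x + t • (x' - x) - (x + (0 : ℝ) • (x' - x)) = t • (x' - x) := by module
    rw [e, norm_smul, Real.norm_of_nonneg ht.1] at h1
    refine (mul_le_mul_of_nonneg_right h1 (norm_nonneg _)).trans (le_of_eq ?_)
    ring
  have h1 := le_of_deriv_le_add_mul (K := D.L * ‖x' - x‖ ^ 2) hd fun t ht => by
    have := (abs_le.1 (hb t ⟨ht.1, ht.2.le⟩)).2
    linarith
  have h2 := le_of_deriv_le_add_mul (K := D.L * ‖x' - x‖ ^ 2) (fun t ht => (hd t ht).neg)
    fun t ht => by
      have := (abs_le.1 (hb t ⟨ht.1, ht.2.le⟩)).1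
      linarith
  simp only [one_smul, zero_smul, add_zero, add_sub_cancel, Pi.neg_apply] at h1 h2
  rw [abs_le]
  constructor <;> linarith

/-- Quadratic lower bound for `fᵢ(x, ·)`. -/
theorem FunAssumption.le_snd (hfun : D.FunAssumption) (i : Fin m) {x : Vec n₁}
    {y y' : Vec n₂} (hx : x ∈ effDom D.g) (hy : y ∈ effDom D.h) (hy' : y' ∈ effDom D.h) :
    D.f i (WithLp.toLp 2 (x, y)) + inner ℝ (D.gradY i x y) (y' - y) - D.L / 2 * ‖y' - y‖ ^ 2
      ≤ D.f i (WithLp.toLp 2 (x, y')) := by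
  have hseg : ∀ t ∈ Set.Icc (0 : ℝ) 1, y + t • (y' - y) ∈ effDom D.h := fun t ht =>
    (hfun.h_convex.toReal_segment_le hy hy' ht).1
  have hd : ∀ t ∈ Set.Icc (0 : ℝ) 1, HasDerivAt
      (fun t : ℝ => D.f i (WithLp.toLp 2 (x, y + t • (y' - y))))
      (inner ℝ (D.gradY i x (y + t • (y' - y))) (y' - y)) t :=
    fun t ht => hfun.hasDerivAt_snd i hx (hseg t ht)
  have h2 := le_of_deriv_le_add_mul (K := D.L * ‖y' - y‖ ^ 2) (fun t ht => (hd t ht).neg)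
    fun t ht => by
      have ht' : t ∈ Set.Icc (0 : ℝ) 1 := ⟨ht.1, ht.2.le⟩
      have h1 := hfun.norm_gradY_sub_le_snd i hx (hseg t ht') (hseg 0 (by simp))
      have e : y + t • (y' - y) - (y + (0 : ℝ) • (y' - y)) = t • (y' - y) := by module
      rw [e, norm_smul, Real.norm_of_nonneg ht.1] at h1
      have h3 := (abs_le.1 (abs_real_inner_le_norm (D.gradY i x (y + t • (y' - y))
        - D.gradY i x (y + (0 : ℝ) • (y' - y))) (y' - y))).1
      have h4 := mul_le_mul_of_nonneg_right h1 (norm_nonneg (y' - y))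
      rw [inner_sub_left] at h3
      linarith
  simp only [one_smul, zero_smul, add_zero, add_sub_cancel, Pi.neg_apply] at h2
  linarith

/-- Strong concavity of `fᵢ(x, ·)`. -/
theorem FunAssumption.snd_le (hfun : D.FunAssumption) (i : Fin m) {x : Vec n₁}
    {y y' : Vec n₂} (hx : x ∈ effDom D.g) (hy : y ∈ effDom D.h) (hy' : y' ∈ effDom D.h) :
    D.f i (WithLp.toLp 2 (x, y')) ≤
      D.f i (WithLp.toLp 2 (x, y)) + inner ℝ (D.gradY i x y) (y' - y)
        - D.μ / 2 * ‖y' - y‖ ^ 2 := by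
  have hseg : ∀ t ∈ Set.Icc (0 : ℝ) 1, y + t • (y' - y) ∈ effDom D.h := fun t ht =>
    (hfun.h_convex.toReal_segment_le hy hy' ht).1
  have hd : ∀ t ∈ Set.Icc (0 : ℝ) 1, HasDerivAt
      (fun t : ℝ => D.f i (WithLp.toLp 2 (x, y + t • (y' - y))))
      (inner ℝ (D.gradY i x (y + t • (y' - y))) (y' - y)) t :=
    fun t ht => hfun.hasDerivAt_snd i hx (hseg t ht)
  have h2 := le_of_deriv_le_add_mul (K := -(D.μ * ‖y' - y‖ ^ 2)) hd
    fun t ht => by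
      -- Strong monotonicity between the points at parameters `t` and `0` gives the derivative bound
      -- multiplied by `t`, so `t = 0` is treated apart.
      rcases ht.1.eq_or_lt with rfl | ht0
      · simp
      have ht' : t ∈ Set.Icc (0 : ℝ) 1 := ⟨ht.1, ht.2.le⟩
      have h1 := hfun.strongly_concave i x hx _ (hseg t ht') _ (hseg 0 (by simp))
      have e : y + t • (y' - y) - (y + (0 : ℝ) • (y' - y)) = t • (y' - y) := by module
      rw [e, norm_smul, Real.norm_of_nonneg ht.1, inner_smul_left, real_inner_comm, inner_sub_left,
        conj_trivial] at h1
      refine le_of_mul_le_mul_left ?_ ht0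
      linarith
  simp only [one_smul, zero_smul, add_zero, add_sub_cancel] at h2
  linarith

/-- The first-order optimality condition of `y` for maximizing `fᵢ(x, ·) - h - ⟨c, ·⟩`. -/
def IsOptimalAt (D : Problem m n₁ n₂) (i : Fin m) (x : Vec n₁) (c y : Vec n₂) : Prop :=
  y ∈ effDom D.h ∧ ∀ u ∈ effDom D.h,
    (D.h y).toReal + inner ℝ (D.gradY i x y - c) (u - y) ≤ (D.h u).toReal

/-- Move from `y` towards `u` by a small `t`. Smoothness bounds the loss in `fᵢ` to first order and
convexity bounds the change of `h`. -/
theorem FunAssumption.isOptimalAt_of_isMax (hfun : D.FunAssumption) {i : Fin m} {x : Vec n₁}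
    {c y : Vec n₂} (hx : x ∈ effDom D.g) (hy : y ∈ effDom D.h)
    (hmax : ∀ u ∈ effDom D.h, D.f i (WithLp.toLp 2 (x, u)) - (D.h u).toReal - inner ℝ c u
      ≤ D.f i (WithLp.toLp 2 (x, y)) - (D.h y).toReal - inner ℝ c y) :
    D.IsOptimalAt i x c y := by
  refine ⟨hy, fun u hu => ?_⟩
  refine le_of_forall_le_add_mul (c := D.L / 2 * ‖u - y‖ ^ 2) fun t ht => ?_
  obtain ⟨hm, hle⟩ := hfun.h_convex.toReal_segment_le hy hu ⟨ht.1.le, ht.2⟩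
  have h1 := hmax _ hm
  have h2 := hfun.le_snd i hx hy hm
  simp only [add_sub_cancel_left, inner_add_right, inner_smul_right, norm_smul, mul_pow,
    Real.norm_eq_abs, sq_abs] at h1 h2
  rw [inner_sub_left]
  linarith

theorem IsOptimalAt.isMax (hfun : D.FunAssumption) {i : Fin m} {x : Vec n₁}
    {c y : Vec n₂} (h : D.IsOptimalAt i x c y) (hx : x ∈ effDom D.g) {u : Vec n₂}
    (hu : u ∈ effDom D.h) : D.f i (WithLp.toLp 2 (x, u)) - (D.h u).toReal - inner ℝ c u
      ≤ D.f i (WithLp.toLp 2 (x, y)) - (D.h y).toReal - inner ℝ c y := by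
  have h1 := h.2 u hu
  have h2 := hfun.snd_le i hx h.1 hu
  have h3 : 0 ≤ D.μ / 2 * ‖u - y‖ ^ 2 := by
    have := hfun.μ_pos
    positivity
  rw [inner_sub_left, inner_sub_right c] at h1
  linarith

/-- Test each optimality condition at the other point and add. The values of `h` cancel; strong
monotonicity bounds `μ ‖y - y'‖²` by the effect of changing `x` and `c`. -/
theorem IsOptimalAt.norm_sub_le (hfun : D.FunAssumption) {i : Fin m} {x x' : Vec n₁}
    {c c' y y' : Vec n₂} (h : D.IsOptimalAt i x c y) (h' : D.IsOptimalAt i x' c' y')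
    (hx : x ∈ effDom D.g) (hx' : x' ∈ effDom D.g) :
    D.μ * ‖y - y'‖ ≤ D.L * ‖x - x'‖ + ‖c - c'‖ := by
  rcases (norm_nonneg (y - y')).eq_or_lt with h0 | h0
  · have := hfun.L_pos
    rw [← h0, mul_zero]
    positivity
  have h1 := h.2 y' h'.1
  have h2 := h'.2 y h.1
  have h3 := hfun.strongly_concave i x hx y h.1 y' h'.1
  have h4 := hfun.norm_gradY_sub_le_fst i hx h'.1 hx'
  have h5 := real_inner_le_norm (D.gradY i x y' - D.gradY i x' y') (y - y')
  have h6 := real_inner_le_norm (c' - c) (y - y')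
  rw [norm_sub_rev c'] at h6
  have h7 := mul_le_mul_of_nonneg_right h4 (norm_nonneg (y - y'))
  rw [← neg_sub y y', inner_neg_right] at h1
  rw [real_inner_comm] at h3
  simp only [inner_sub_left] at h1 h2 h3 h5 h6
  refine le_of_mul_le_mul_right (a := ‖y - y'‖) ?_ h0
  linarith

/-- An inexact maximizer with supergradient `ξ` is an exact maximizer of the problem tilted by `ξ`,
so exact and inexact points obey the same stability estimate. -/
theorem FunAssumption.isOptimalAt_of_superdiff (hfun : D.FunAssumption) {X : RowMat m n₁}
    {Λ : RowMat m n₂} {i : Fin m} {y ξ : Vec n₂} (hx : X i ∈ effDom D.g)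
    (hξ : ξ ∈ superdiff (D.dLoc X Λ i) y) :
    D.IsOptimalAt i (X i)
      ((D.L * √(m : ℝ) / 2) • ((∑ j, D.W j i • Λ j) - Λ i) + ξ) y := by
  have hfin : ∀ u ∈ effDom D.h, D.dLoc X Λ i u = ((D.f i (WithLp.toLp 2 (X i, u))
      - (D.h u).toReal - D.L * √(m : ℝ) / 2 * inner ℝ ((∑ j, D.W j i • Λ j) - Λ i) u : ℝ) :
        EReal) := by
    intro u hu
    rw [dLoc, ← hfun.h_convex.coe_toReal hu]
    norm_cast
  have hy : y ∈ effDom D.h := by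
    -- If `h y = ⊤`, then the local objective is `⊥` at `y`, and the supergradient inequality would
    -- make it `⊥` at a point of the domain of `h`.
    by_contra hy
    obtain ⟨u, hu⟩ := hfun.h_convex.nonempty_dom
    have h := hξ u
    rw [hfin u hu, dLoc, eq_top_of_notMem_effDom hy, EReal.sub_top, EReal.bot_sub,
      EReal.bot_add] at h
    exact EReal.coe_ne_bot _ (le_bot_iff.1 h)
  refine hfun.isOptimalAt_of_isMax hx hy fun u hu => ?_
  have h := hξ u
  rw [hfin u hu, hfin y hy, ← EReal.coe_add, EReal.coe_le_coe_iff, inner_sub_right] at h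
  simp only [inner_add_left, inner_smul_left, conj_trivial]
  linarith

/-- Optimality says that `∇_y fᵢ(x, y) - c` is a subgradient of `h` at `y`. This affine minorant
supplies the coercivity needed for exact maximizers to exist. -/
theorem IsOptimalAt.exists_affine_le {i : Fin m} {x : Vec n₁} {c y : Vec n₂}
    (h : D.IsOptimalAt i x c y) :
    ∃ (a : Vec n₂) (b : ℝ), ∀ u ∈ effDom D.h, b + inner ℝ a u ≤ (D.h u).toReal := by
  refine ⟨D.gradY i x y - c, (D.h y).toReal - inner ℝ (D.gradY i x y - c) y, fun u hu => ?_⟩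
  have := h.2 u hu
  rw [inner_sub_right] at this
  linarith

/-- Weierstrass: the quadratic growth from strong concavity beats the affine minorant of `h`, so
only a bounded set of points competes. -/
theorem FunAssumption.exists_isOptimalAt (hfun : D.FunAssumption)
    (haff : ∃ (a : Vec n₂) (b : ℝ), ∀ u ∈ effDom D.h, b + inner ℝ a u ≤ (D.h u).toReal)
    (i : Fin m) {x : Vec n₁} (hx : x ∈ effDom D.g) (c : Vec n₂) :
    ∃ y, D.IsOptimalAt i x c y := by
  obtain ⟨a, b, hab⟩ := haff
  obtain ⟨y₀, hy₀⟩ := hfun.h_convex.nonempty_dom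
  have hμ := hfun.μ_pos
  set F : Vec n₂ → ℝ := fun u => inner ℝ c u - D.f i (WithLp.toLp 2 (x, u)) with hF
  set v := D.gradY i x y₀ - c with hv
  set q := a - v with hq
  set K₁ := (D.h y₀).toReal - b - inner ℝ a y₀ with hK₁
  -- A competitor at distance `d` from `y₀` satisfies `μ/2 d² ≤ K₁ + ‖q‖ d`. If `d > 1` the right
  -- side is at most `(K₁ + ‖q‖) d`, which bounds `d`.
  set R := (2 * ‖q‖ + 2 * K₁) / D.μ + 1 with hR
  have hK₁0 : 0 ≤ K₁ := by
    have := hab y₀ hy₀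
    rw [hK₁]
    linarith
  have hub : ∀ u ∈ effDom D.h, (D.h y₀).toReal + F y₀ - inner ℝ v (u - y₀)
      + D.μ / 2 * ‖u - y₀‖ ^ 2 ≤ (D.h y₀).toReal + F u := by
    intro u hu
    have h1 := hfun.snd_le i hx hy₀ hu
    simp only [hF, hv, inner_sub_left, inner_sub_right] at h1 ⊢
    linarith
  set M := (D.h y₀).toReal + ‖v‖ * R with hM
  have hR1 : 1 ≤ R := le_add_of_nonneg_left (by positivity)
  have hR0 : 0 ≤ R := zero_le_one.trans hR1
  have hlevel : ∀ u ∈ effDom D.h, (D.h u).toReal + F u ≤ (D.h y₀).toReal + F y₀ →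
      ‖u - y₀‖ ≤ R ∧ (D.h u).toReal ≤ M := by
    intro u hu hle
    have h1 := hub u hu
    have h2 := hab u hu
    have h3 : D.μ / 2 * ‖u - y₀‖ ^ 2 ≤ K₁ + ‖q‖ * ‖u - y₀‖ := by
      have h4 := (abs_le.1 (abs_real_inner_le_norm q (u - y₀))).1
      simp only [hq, hK₁, inner_sub_left, inner_sub_right] at h4 h1 ⊢
      linarith
    have hle1 : ‖u - y₀‖ ≤ R := by
      by_contra! hlt
      have h5 : 1 < ‖u - y₀‖ := lt_of_le_of_lt hR1 hlt
      have h6 : 2 * ‖q‖ + 2 * K₁ < D.μ * ‖u - y₀‖ := by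
        have : (2 * ‖q‖ + 2 * K₁) / D.μ < ‖u - y₀‖ := by linarith
        rw [div_lt_iff₀ hμ] at this
        linarith
      have h7 : (2 * ‖q‖ + 2 * K₁) * ‖u - y₀‖ < D.μ * ‖u - y₀‖ * ‖u - y₀‖ :=
        mul_lt_mul_of_pos_right h6 (by linarith)
      have h8 : K₁ * 1 ≤ K₁ * ‖u - y₀‖ := mul_le_mul_of_nonneg_left h5.le hK₁0
      linarith
    refine ⟨hle1, ?_⟩
    have h4 := real_inner_le_norm v (u - y₀)
    have h5 := mul_le_mul_of_nonneg_left hle1 (norm_nonneg v)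
    have h6 : 0 ≤ D.μ / 2 * ‖u - y₀‖ ^ 2 := by positivity
    rw [hM]
    linarith
  -- A sublevel set of `h` alone, not of `h + F`: it is closed by semicontinuity of `h` and lies in
  -- `dom h`, where `F` is known to be continuous.
  set S : Set (Vec n₂) := {u | D.h u ≤ (M : EReal)} ∩ Metric.closedBall y₀ R with hS
  have hSdom : S ⊆ effDom D.h := fun u hu => lt_of_le_of_lt hu.1 (EReal.coe_lt_top _)
  have hSc : IsCompact S := by
    refine (isCompact_closedBall y₀ R).inter_left ?_
    exact hfun.h_convex.lsc.isClosed_preimage (M : EReal)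
  have hy₀S : y₀ ∈ S := by
    obtain ⟨h1, h2⟩ := hlevel y₀ hy₀ le_rfl
    refine ⟨?_, by simpa using hR0⟩
    change D.h y₀ ≤ _
    rwa [← hfun.h_convex.coe_toReal hy₀, EReal.coe_le_coe_iff]
  have hlsc : LowerSemicontinuousOn (fun u => D.h u + (F u : EReal)) S := by
    refine LowerSemicontinuousOn.add' (hfun.h_convex.lsc.lowerSemicontinuousOn _) ?_ fun u hu => ?_
    · refine ContinuousOn.lowerSemicontinuousOn fun u hu => ?_
      have h1 : ContinuousAt F u := (continuous_const.inner continuous_id).continuousAt.sub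
        (hfun.hasGradientAt_snd i hx (hSdom hu)).continuousAt
      exact (continuous_coe_real_ereal.continuousAt.comp h1).continuousWithinAt
    · exact EReal.continuousAt_add (.inr (EReal.coe_ne_bot _)) (.inr (EReal.coe_ne_top _))
  obtain ⟨y, hyS, hy⟩ := hlsc.exists_isMinOn ⟨y₀, hy₀S⟩ hSc
  have hreal : ∀ u ∈ S, (D.h y).toReal + F y ≤ (D.h u).toReal + F u := by
    intro u hu
    have h1 : D.h y + (F y : EReal) ≤ D.h u + (F u : EReal) := hy hu
    rwa [← hfun.h_convex.coe_toReal (hSdom hu), ← hfun.h_convex.coe_toReal (hSdom hyS),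
      ← EReal.coe_add, ← EReal.coe_add, EReal.coe_le_coe_iff] at h1
  refine ⟨y, hfun.isOptimalAt_of_isMax hx (hSdom hyS) fun u hu => ?_⟩
  suffices (D.h y).toReal + F y ≤ (D.h u).toReal + F u by
    simp only [hF] at this
    linarith
  by_cases hle : (D.h u).toReal + F u ≤ (D.h y₀).toReal + F y₀
  · obtain ⟨h1, h2⟩ := hlevel u hu hle
    refine hreal u ⟨?_, by simpa [dist_eq_norm] using h1⟩
    change D.h u ≤ _
    rwa [← hfun.h_convex.coe_toReal hu, EReal.coe_le_coe_iff]
  · exact (hreal y₀ hy₀S).trans (not_le.1 hle).le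

end Problem

/-! ### Scalar inequalities behind the descent. -/

/-- Telescoping bounds the partial sums of `a` by `Ψ 0 - M + ∑ b`, so `a` is summable. -/
theorem tendsto_zero_of_descent {Ψ a b : ℕ → ℝ} {M : ℝ} (hΨ : ∀ t, M ≤ Ψ t) (ha : ∀ t, 0 ≤ a t)
    (hb0 : ∀ t, 0 ≤ b t) (hb : Summable b) (h : ∀ t, Ψ (t + 1) ≤ Ψ t - a t + b t) :
    Tendsto a atTop (𝓝 0) := by
  refine (summable_of_sum_range_le (c := Ψ 0 - M + ∑' t, b t) ha fun n => ?_).tendsto_atTop_zero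
  have h1 : ∀ n, Ψ n + ∑ t ∈ Finset.range n, a t ≤ Ψ 0 + ∑ t ∈ Finset.range n, b t := by
    intro n
    induction n with
    | zero => simp
    | succ n ih =>
      rw [Finset.sum_range_succ, Finset.sum_range_succ]
      have := h n
      linarith
  have h2 := hb.sum_le_tsum (Finset.range n) fun t _ => hb0 t
  have h3 := h1 n
  have h4 := hΨ n
  linarith

/-- The right side minus `((1 - r) a + b)²` is `(1 - r)/r · (r a - b)²`. Squaring thus keeps the
full contraction factor `1 - r`, at the price of `1/r` on the perturbation. -/
theorem sq_le_of_le_contraction {r a b c : ℝ} (hr : 0 < r) (hr1 : r ≤ 1) (hc : 0 ≤ c)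
    (h : c ≤ (1 - r) * a + b) : c ^ 2 ≤ (1 - r) * a ^ 2 + b ^ 2 / r := by
  have h1 : c ^ 2 ≤ ((1 - r) * a + b) ^ 2 := pow_le_pow_left₀ hc h 2
  have h2 : (1 - r) * a ^ 2 + b ^ 2 / r - ((1 - r) * a + b) ^ 2
      = (1 - r) / r * (r * a - b) ^ 2 := by
    field_simp
    ring
  have h3 : 0 ≤ (1 - r) / r * (r * a - b) ^ 2 :=
    mul_nonneg (div_nonneg (by linarith) hr.le) (sq_nonneg _)
  linarith

set_option maxHeartbeats 1000000 in
/-- One step of the Lyapunov function, in normalized quantities: `α`, `β` are the consensus errors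
of the primal variable and of the gradient tracker, `D`, `E` the lengths of the steps. -/
theorem lyapunov_step {r κ s α α' β β' D E e ξ N y Δ : ℝ}
    (hr : 0 < r) (hr1 : r ≤ 1) (hκ : 0 < κ) (hs0 : 0 < s) (hs : s ^ 2 = 1 + 6 * κ ^ 2)
    (hα : 0 ≤ α) (hα' : 0 ≤ α') (hβ : 0 ≤ β) (hβ' : 0 ≤ β')
    (hαstep : α' ≤ (1 - r) * α + r ^ 2 / (5 * s) * β)
    (hβstep : β' ≤ (1 - r) * β + ξ)
    (hξ : ξ ^ 2 ≤ (1 + 2 * κ ^ 2) * (D ^ 2 + 2 * α ^ 2 + 2 * α' ^ 2) + 4 * κ ^ 2 * E ^ 2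
      + 4 * e ^ 2)
    (hN : N ^ 2 ≤ (1 + 2 * κ ^ 2) * α ^ 2 + 4 * e ^ 2)
    (hy : y ^ 2 ≤ 2 * κ ^ 2 * α ^ 2 + 4 * e ^ 2)
    (hΔ : Δ ≤ N * D + y * E + β * α' - 5 * s / r ^ 2 * D ^ 2
      - 5 * s / r ^ 2 * (α' ^ 2 - (1 - r) * α * α') - (9 * κ + 2) / r ^ 2 * E ^ 2
      + D ^ 2 / 2 + 2 * κ * (D ^ 2 + E ^ 2)) :
    Δ + 10 * s / r ^ 3 * (α' ^ 2 - α ^ 2) + 1 / (s * r) * (β' ^ 2 - β ^ 2) ≤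
      -(2 * D ^ 2 + E ^ 2 + α ^ 2 + 3 / 25 / s * β ^ 2) + 8 / r ^ 2 * e ^ 2 := by
  have hs1 : 1 ≤ s := by nlinarith [sq_nonneg κ]
  have hκs : κ ≤ s / 2 := by nlinarith [sq_nonneg κ]
  have hq : 1 + 2 * κ ^ 2 ≤ s ^ 2 := by nlinarith [sq_nonneg κ]
  have hα2 := sq_le_of_le_contraction hr hr1 hα' hαstep
  have hβ2 := sq_le_of_le_contraction hr hr1 hβ' hβstep
  obtain ⟨R, hR⟩ : ∃ R, R = 1 / r ^ 2 := ⟨_, rfl⟩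
  have hR1 : 1 ≤ R := by
    rw [hR, le_div_iff₀ (by positivity)]
    linarith [pow_le_one₀ (n := 2) hr.le hr1]
  obtain ⟨w, hw⟩ : ∃ w, w = 1 / s := ⟨_, rfl⟩
  have hw0 : 0 < w := by rw [hw]; positivity
  have hw1 : w ≤ 1 := by rw [hw, div_le_one hs0]; exact hs1
  have hws : w * s = 1 := by rw [hw]; field_simp
  -- the consensus error of `x`
  have h1 : 10 * s / r ^ 3 * (α' ^ 2 - α ^ 2) ≤ -(10 * s * R * α ^ 2) + 2 / 5 * w * β ^ 2 := by
    have : 10 * s / r ^ 3 * (α' ^ 2 - α ^ 2) ≤ 10 * s / r ^ 3 *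
        ((1 - r) * α ^ 2 + (r ^ 2 / (5 * s) * β) ^ 2 / r - α ^ 2) := by gcongr
    refine this.trans (le_of_eq ?_)
    rw [hR, hw]
    field_simp
    ring
  have hα2' : α' ^ 2 ≤ α ^ 2 + r ^ 3 / 25 * w ^ 2 * β ^ 2 := by
    have e1 : (r ^ 2 / (5 * s) * β) ^ 2 / r = r ^ 3 / 25 * w ^ 2 * β ^ 2 := by
      rw [hw]
      field_simp
      ring
    have : 0 ≤ r * α ^ 2 := by positivity
    rw [e1] at hα2
    linarith
  -- the consensus error of the tracker
  have h2 : 1 / (s * r) * (β' ^ 2 - β ^ 2) ≤ -(w * β ^ 2) + w * R * ξ ^ 2 := by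
    have : 1 / (s * r) * (β' ^ 2 - β ^ 2) ≤ 1 / (s * r) *
        ((1 - r) * β ^ 2 + ξ ^ 2 / r - β ^ 2) := by gcongr
    refine this.trans (le_of_eq ?_)
    rw [hR, hw]
    field_simp
    ring
  have h3 : w * R * ξ ^ 2 ≤ s * R * D ^ 2 + 4 * s * R * α ^ 2 + 2 / 25 * w * β ^ 2
      + 2 * κ * R * E ^ 2 + 4 * R * e ^ 2 := by
    have a1 : ξ ^ 2 ≤ s ^ 2 * (D ^ 2 + 4 * α ^ 2 + 2 * (r ^ 3 / 25 * w ^ 2 * β ^ 2))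
        + 2 * κ * s * E ^ 2 + 4 * e ^ 2 := by
      have b1 : (1 + 2 * κ ^ 2) * (D ^ 2 + 2 * α ^ 2 + 2 * α' ^ 2) ≤
          s ^ 2 * (D ^ 2 + 4 * α ^ 2 + 2 * (r ^ 3 / 25 * w ^ 2 * β ^ 2)) := by
        refine mul_le_mul hq (by linarith) (by positivity) (by positivity)
      have b2 : 4 * κ ^ 2 * E ^ 2 ≤ 2 * κ * s * E ^ 2 := by
        have : 4 * κ ^ 2 ≤ 2 * κ * s := by linarith [mul_le_mul_of_nonneg_left hκs hκ.le]
        gcongr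
      linarith
    have a2 : w * R * ξ ^ 2 ≤ w * R * (s ^ 2 * (D ^ 2 + 4 * α ^ 2
        + 2 * (r ^ 3 / 25 * w ^ 2 * β ^ 2)) + 2 * κ * s * E ^ 2 + 4 * e ^ 2) := by gcongr
    have a3 : w * R * (s ^ 2 * (D ^ 2 + 4 * α ^ 2 + 2 * (r ^ 3 / 25 * w ^ 2 * β ^ 2))
        + 2 * κ * s * E ^ 2 + 4 * e ^ 2) = s * R * D ^ 2 + 4 * s * R * α ^ 2
          + r * (2 / 25 * w * β ^ 2) + 2 * κ * R * E ^ 2 + w * (4 * R * e ^ 2) := by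
      rw [hR, hw]
      field_simp
    have a4 : r * (2 / 25 * w * β ^ 2) ≤ 2 / 25 * w * β ^ 2 :=
      mul_le_of_le_one_left (by positivity) hr1
    have a5 : w * (4 * R * e ^ 2) ≤ 4 * R * e ^ 2 :=
      mul_le_of_le_one_left (by positivity) hw1
    linarith
  have h4 : β * α' ≤ 2 / 5 * w * β ^ 2 + 5 / 4 * s * α ^ 2 := by
    have a1 : β * α' ≤ β * (1 * α + 1 / 5 * w * β) := by
      refine mul_le_mul_of_nonneg_left (hαstep.trans ?_) hβ
      have e1 : r ^ 2 / (5 * s) = r ^ 2 * (1 / 5 * w) := by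
        rw [hw]
        field_simp
      rw [e1]
      have : r ^ 2 ≤ 1 := pow_le_one₀ hr.le hr1
      have : r ^ 2 * (1 / 5 * w) ≤ 1 / 5 * w := mul_le_of_le_one_left (by positivity) this
      gcongr
      linarith
    have a2 : β * α ≤ 1 / 5 * w * β ^ 2 + 5 / 4 * s * α ^ 2 := by
      have : 1 / 5 * w * β ^ 2 + 5 / 4 * s * α ^ 2 - β * α
          = 1 / 5 * w * (β - 5 / 2 * s * α) ^ 2 := by
        linear_combination (β * α - 5 / 4 * s * α ^ 2) * hws
      have : 0 ≤ 1 / 5 * w * (β - 5 / 2 * s * α) ^ 2 := by positivity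
      linarith
    linarith
  have h5 : -(5 * s / r ^ 2 * (α' ^ 2 - (1 - r) * α * α')) ≤ 5 / 4 * s * R * α ^ 2 := by
    have e1 : 5 * s / r ^ 2 = 5 * s * R := by
      rw [hR]
      field_simp
    have a1 : (1 - r) * α * α' ≤ α' ^ 2 + 1 / 4 * α ^ 2 := by
      have : (1 - r) * (α * α') ≤ α * α' := mul_le_of_le_one_left (by positivity) (by linarith)
      linarith [sq_nonneg (α' - α / 2)]
    have a2 : 5 * s * R * ((1 - r) * α * α' - α' ^ 2) ≤ 5 * s * R * (1 / 4 * α ^ 2) := by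
      gcongr
      linarith
    rw [e1]
    linarith
  have h6 : N * D ≤ 1 / 2 * s * D ^ 2 + 1 / 2 * s * α ^ 2 + 2 * e ^ 2 := by
    have a1 : N * D ≤ 1 / 2 * s * D ^ 2 + 1 / 2 * w * N ^ 2 := by
      have : 1 / 2 * s * D ^ 2 + 1 / 2 * w * N ^ 2 - N * D = 1 / 2 * w * (N - s * D) ^ 2 := by
        linear_combination (N * D - 1 / 2 * s * D ^ 2) * hws
      have : 0 ≤ 1 / 2 * w * (N - s * D) ^ 2 := by positivity
      linarith
    have a2 : 1 / 2 * w * N ^ 2 ≤ 1 / 2 * w * (s ^ 2 * α ^ 2 + 4 * e ^ 2) := by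
      have : (1 + 2 * κ ^ 2) * α ^ 2 ≤ s ^ 2 * α ^ 2 := by gcongr
      gcongr
      linarith
    have a3 : 1 / 2 * w * (s ^ 2 * α ^ 2 + 4 * e ^ 2) = 1 / 2 * s * α ^ 2 + 2 * (w * e ^ 2) := by
      linear_combination (1 / 2 * s * α ^ 2) * hws
    have a4 : w * e ^ 2 ≤ e ^ 2 := mul_le_of_le_one_left (by positivity) hw1
    linarith
  have h7 : y * E ≤ (κ + 1 / 2) * E ^ 2 + 1 / 4 * s * α ^ 2 + 2 * e ^ 2 := by
    have a1 : y * E ≤ (κ + 1 / 2) * E ^ 2 + y ^ 2 / (4 * κ + 2) := by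
      have : (κ + 1 / 2) * E ^ 2 + y ^ 2 / (4 * κ + 2) - y * E
          = (y - (2 * κ + 1) * E) ^ 2 / (4 * κ + 2) := by
        field_simp
        ring
      have : 0 ≤ (y - (2 * κ + 1) * E) ^ 2 / (4 * κ + 2) := by positivity
      linarith
    have a2 : y ^ 2 / (4 * κ + 2) ≤ 1 / 2 * κ * α ^ 2 + 2 * e ^ 2 := by
      rw [div_le_iff₀ (by positivity)]
      have : 0 ≤ κ * α ^ 2 + 8 * κ * e ^ 2 := by positivity
      linarith
    have a3 : κ * α ^ 2 ≤ s / 2 * α ^ 2 := by gcongr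
    linarith
  have hD : s * D ^ 2 ≤ s * R * D ^ 2 := by
    have := mul_le_mul_of_nonneg_left hR1 (show 0 ≤ s * D ^ 2 by positivity)
    linarith
  have hD1 : D ^ 2 ≤ s * D ^ 2 := le_mul_of_one_le_left (by positivity) hs1
  have hD2 : κ * D ^ 2 ≤ s / 2 * D ^ 2 := by gcongr
  have hA : s * α ^ 2 ≤ s * R * α ^ 2 := by
    have := mul_le_mul_of_nonneg_left hR1 (show 0 ≤ s * α ^ 2 by positivity)
    linarith
  have hA1 : α ^ 2 ≤ s * α ^ 2 := le_mul_of_one_le_left (by positivity) hs1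
  have hE : κ * E ^ 2 ≤ κ * R * E ^ 2 := by
    have := mul_le_mul_of_nonneg_left hR1 (show 0 ≤ κ * E ^ 2 by positivity)
    linarith
  have hE0 : 0 ≤ κ * E ^ 2 := by positivity
  have hE1 : E ^ 2 ≤ R * E ^ 2 := le_mul_of_one_le_left (by positivity) hR1
  have he1 : e ^ 2 ≤ R * e ^ 2 := le_mul_of_one_le_left (by positivity) hR1
  have e1 : 5 * s / r ^ 2 * D ^ 2 = 5 * (s * R * D ^ 2) := by rw [hR]; ring
  have e2 : (9 * κ + 2) / r ^ 2 * E ^ 2 = 9 * (κ * R * E ^ 2) + 2 * (R * E ^ 2) := by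
    rw [hR]
    ring
  have e3 : 3 / 25 / s * β ^ 2 = 3 / 25 * (w * β ^ 2) := by rw [hw]; ring
  have e4 : 8 / r ^ 2 * e ^ 2 = 8 * (R * e ^ 2) := by rw [hR]; ring
  rw [e1, e2] at hΔ
  rw [e3, e4]
  -- Balance of coefficients, using `R, s ≥ 1` and `2κ ≤ s`. For `s R D²`: `-5 + 1 + 1/2 + 1/2 + 1 =
  -- -2`. For `s R α²`: `-10 + 4 + 5/4 + 5/4 + 1/2 + 1/4 < -1`. For `E²`: `9κR` covers `2κR + κ +
  -- 2κ`, and `2R` covers `1/2` with at least `1` left. For `e²`: `4R + 2 + 2 ≤ 8R`.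
  linarith [sq_nonneg E, sq_nonneg α, sq_nonneg D]

/-! ### The value function `P`, its maximizers and its gradient. -/

theorem ereal_coe_sum {ι : Type*} (s : Finset ι) (f : ι → ℝ) :
    ((∑ i ∈ s, f i : ℝ) : EReal) = ∑ i ∈ s, (f i : EReal) := by
  classical
  induction s using Finset.induction_on with
  | empty => simp
  | insert a s ha ih => rw [Finset.sum_insert ha, Finset.sum_insert ha, EReal.coe_add, ih]

theorem ereal_sum_eq_bot {ι : Type*} {s : Finset ι} {f : ι → EReal} {i : ι} (hi : i ∈ s)
    (h : f i = ⊥) : ∑ i ∈ s, f i = ⊥ := by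
  classical
  rw [← Finset.add_sum_erase s f hi, h, EReal.bot_add]

theorem hasGradientWithinAt_of_abs_sub_le_sq {E : Type*} [NormedAddCommGroup E]
    [InnerProductSpace ℝ E] [CompleteSpace E] {F : E → ℝ} {G u : E} {s : Set E} {C : ℝ}
    (h : ∀ v ∈ s, |F v - F u - inner ℝ G (v - u)| ≤ C * ‖v - u‖ ^ 2) :
    HasGradientWithinAt F G s u := by
  rw [hasGradientWithinAt_iff_isLittleO]
  have h1 : (fun v => F v - F u - inner ℝ G (v - u)) =O[𝓝[s] u] fun v => ‖v - u‖ ^ 2 := by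
    refine Asymptotics.IsBigO.of_bound C ?_
    filter_upwards [self_mem_nhdsWithin] with v hv
    simpa using h v hv
  refine h1.trans_isLittleO ?_
  have h2 : Tendsto (fun v => v - u) (𝓝[s] u) (𝓝 0) := by
    have : Tendsto (fun v => v - u) (𝓝 u) (𝓝 (u - u)) :=
      (continuous_id.sub continuous_const).tendsto u
    rw [sub_self] at this
    exact this.mono_left nhdsWithin_le_nhds
  exact (Asymptotics.isLittleO_norm_pow_id one_lt_two).comp_tendsto h2

namespace Problem

variable {m n₁ n₂ : ℕ} {D : Problem m n₁ n₂}

/-- The rows of `(L√m/2) (W - I)ᵀ Λ`. -/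
def shift (D : Problem m n₁ n₂) (Λ : RowMat m n₂) : RowMat m n₂ :=
  (D.L * √(m : ℝ) / 2) • matMul (D.W - 1).transpose Λ

theorem shift_apply (Λ : RowMat m n₂) (i : Fin m) :
    D.shift Λ i = (D.L * √(m : ℝ) / 2) • ((∑ j, D.W j i • Λ j) - Λ i) := by
  have : (D.W - 1).transpose = D.W.transpose - 1 := by simp
  rw [shift, this, PiLp.smul_apply, matMul_sub_one_apply]
  rfl

theorem shift_sub (Λ Λ' : RowMat m n₂) : D.shift Λ - D.shift Λ' = D.shift (Λ - Λ') := by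
  rw [shift, shift, shift, matMul_sub, smul_sub]

theorem norm_shift_le (hL : 0 < D.L) (hW : specNorm (D.W - 1) ≤ 2) (Λ : RowMat m n₂) :
    ‖D.shift Λ‖ ≤ D.L * √(m : ℝ) * ‖Λ‖ := by
  rw [shift, norm_smul, Real.norm_of_nonneg (by positivity)]
  have h1 := norm_matMul_transpose_le (D.W - 1) Λ
  have h2 := mul_le_mul_of_nonneg_right hW (norm_nonneg Λ)
  have h3 : 0 ≤ D.L * √(m : ℝ) / 2 := by positivity
  have := mul_le_mul_of_nonneg_left (h1.trans h2) h3
  linarith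

/-- The coupling term of `Φ` is the average of the linear terms of the local problems, since `(1/m)
· L√m/2 = L/(2√m)`. This is what decouples the maximization over `Y`. -/
theorem inner_shift (hm : 0 < m) (Λ Y : RowMat m n₂) :
    1 / (m : ℝ) * inner ℝ (D.shift Λ) Y
      = D.L / (2 * √(m : ℝ)) * inner ℝ Λ (matMul (D.W - 1) Y) := by
  have h0 : (0 : ℝ) < m := by exact_mod_cast hm
  rw [inner_matMul, shift, inner_smul_left, conj_trivial, ← mul_assoc]
  congr 1
  have h1 : (m : ℝ) = √(m : ℝ) * √(m : ℝ) := (Real.mul_self_sqrt h0.le).symm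
  have h2 : 0 < √(m : ℝ) := Real.sqrt_pos.2 h0
  rw [h1, Real.sqrt_mul_self h2.le]
  field_simp

/-- `S x Λ` collects the maximizers of the local functions at `x ∈ dom g`. -/
def IsResponse (D : Problem m n₁ n₂) (S : Vec n₁ → RowMat m n₂ → RowMat m n₂) : Prop :=
  ∀ x ∈ effDom D.g, ∀ Λ i, D.IsOptimalAt i x (D.shift Λ i) (S x Λ i)

/-- The value of `Φ(𝟏xᵀ, Λ, Y)` when the rows of `Y` are in the domain of `h`. -/
def phiReal (D : Problem m n₁ n₂) (x : Vec n₁) (Λ Y : RowMat m n₂) : ℝ :=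
  1 / (m : ℝ) * ∑ i, (D.f i (WithLp.toLp 2 (x, Y i)) - (D.h (Y i)).toReal
    - inner ℝ (D.shift Λ i) (Y i))

theorem Phi_rep_eq (hm : 0 < m) (hfun : D.FunAssumption) (x : Vec n₁) (Λ : RowMat m n₂)
    {Y : RowMat m n₂} (hY : ∀ i, Y i ∈ effDom D.h) :
    D.Phi (rep m x) Λ Y = (D.phiReal x Λ Y : EReal) := by
  have h1 : ∀ i, ((D.f i (WithLp.toLp 2 (x, Y i)) : ℝ) : EReal) - D.h (Y i) =
      ((D.f i (WithLp.toLp 2 (x, Y i)) - (D.h (Y i)).toReal : ℝ) : EReal) := fun i => by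
    rw [EReal.coe_sub, hfun.h_convex.coe_toReal (hY i)]
  simp only [Phi, rep_apply, h1]
  rw [← ereal_coe_sum, ← EReal.coe_mul, ← EReal.coe_sub, phiReal, ← inner_shift hm, rowMat_inner,
    ← mul_sub, ← Finset.sum_sub_distrib]

theorem Phi_rep_eq_bot (hm : 0 < m) (x : Vec n₁) (Λ : RowMat m n₂)
    {Y : RowMat m n₂} {i : Fin m} (hY : Y i ∉ effDom D.h) :
    D.Phi (rep m x) Λ Y = ⊥ := by
  have h0 : (0 : ℝ) < 1 / m := by positivity
  rw [Phi, ereal_sum_eq_bot (Finset.mem_univ i)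
    (by rw [eq_top_of_notMem_effDom hY, EReal.sub_top]), EReal.coe_mul_bot_of_pos h0,
    EReal.bot_sub]

theorem IsResponse.P_eq (hm : 0 < m) (hfun : D.FunAssumption)
    {S : Vec n₁ → RowMat m n₂ → RowMat m n₂} (hS : D.IsResponse S) {x : Vec n₁}
    (hx : x ∈ effDom D.g) (Λ : RowMat m n₂) : D.P x Λ = (D.phiReal x Λ (S x Λ) : EReal) := by
  refine le_antisymm (iSup_le fun Y => ?_) ?_
  · by_cases hY : ∀ i, Y i ∈ effDom D.h
    · rw [Phi_rep_eq hm hfun x Λ hY, EReal.coe_le_coe_iff]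
      refine mul_le_mul_of_nonneg_left (Finset.sum_le_sum fun i _ => ?_) (by positivity)
      exact (hS x hx Λ i).isMax hfun hx (hY i)
    · push Not at hY
      obtain ⟨i, hi⟩ := hY
      rw [Phi_rep_eq_bot hm x Λ hi]
      exact bot_le
  · rw [← Phi_rep_eq hm hfun x Λ fun i => (hS x hx Λ i).1]
    exact le_iSup (fun Y => D.Phi (rep m x) Λ Y) (S x Λ)

/-- Restrict the maximum over `Y` to consensus matrices `𝟏yᵀ`, on which `(W - I) Y = 0`. This bounds
the Lyapunov function from below. -/
theorem p_le_P (hm : 0 < m) (hfun : D.FunAssumption)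
    (x : Vec n₁) (Λ : RowMat m n₂) (hrow : ∀ i, ∑ j, D.W i j = 1) :
    D.p x ≤ D.P x Λ := by
  refine iSup_le fun y => ?_
  by_cases hy : y ∈ effDom D.h
  · refine le_trans (le_of_eq ?_) (le_iSup (fun Y => D.Phi (rep m x) Λ Y) (rep m y))
    have h0 : (m : ℝ) ≠ 0 := by positivity
    have h1 : matMul (D.W - 1) (rep m y) = 0 := by
      ext i : 1
      rw [matMul_sub_one_apply]
      simp [← Finset.sum_smul, hrow]
    rw [Phi_rep_eq hm hfun x Λ fun _ => hy, phiReal, Finset.sum_sub_distrib,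
      ← hfun.h_convex.coe_toReal hy, ← EReal.coe_sub, EReal.coe_eq_coe_iff, mul_sub,
      ← rowMat_inner, inner_shift hm, h1, inner_zero_right, Finset.sum_sub_distrib]
    simp only [rep_apply, Finset.sum_const, Finset.card_univ, Fintype.card_fin, nsmul_eq_mul]
    field_simp
    ring
  · rw [eq_top_of_notMem_effDom hy, EReal.sub_top]
    exact bot_le

/-- `∇ₓP(x, Λ)`. -/
def gradPX (D : Problem m n₁ n₂) (x : Vec n₁) (Y : RowMat m n₂) : Vec n₁ :=
  (1 / (m : ℝ)) • ∑ i, D.gradX i x (Y i)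

/-- `∇_ΛP(x, Λ)`. -/
def gradPLam (D : Problem m n₁ n₂) (Y : RowMat m n₂) : RowMat m n₂ :=
  -((D.L / (2 * √(m : ℝ))) • matMul (D.W - 1) Y)

theorem inner_gradPLam (hm : 0 < m) (Λ Y : RowMat m n₂) :
    inner ℝ (D.gradPLam Y) Λ = -(1 / (m : ℝ) * inner ℝ (D.shift Λ) Y) := by
  rw [inner_shift hm, gradPLam, inner_neg_left, inner_smul_left, conj_trivial, real_inner_comm]

theorem IsResponse.norm_sub_sq_le (hfun : D.FunAssumption) (hW : specNorm (D.W - 1) ≤ 2)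
    {S : Vec n₁ → RowMat m n₂ → RowMat m n₂} (hS : D.IsResponse S) {x x' : Vec n₁}
    (hx : x ∈ effDom D.g) (hx' : x' ∈ effDom D.g) (Λ Λ' : RowMat m n₂) :
    D.μ ^ 2 * ‖S x' Λ' - S x Λ‖ ^ 2 ≤
      2 * D.L ^ 2 * (m : ℝ) * (‖x' - x‖ ^ 2 + ‖Λ' - Λ‖ ^ 2) := by
  have hL := hfun.L_pos
  have hμ := hfun.μ_pos
  have h1 : ∀ i, D.μ ^ 2 * ‖(S x' Λ' - S x Λ) i‖ ^ 2 ≤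
      2 * (D.L ^ 2 * ‖x' - x‖ ^ 2) + 2 * ‖(D.shift (Λ' - Λ)) i‖ ^ 2 := by
    intro i
    have h := (hS x' hx' Λ' i).norm_sub_le hfun (hS x hx Λ i) hx' hx
    have h2 := pow_le_pow_left₀ (by positivity) h 2
    rw [← shift_sub]
    simp only [PiLp.sub_apply]
    nlinarith [sq_nonneg (D.L * ‖x' - x‖ - ‖D.shift Λ' i - D.shift Λ i‖)]
  have h2 : ‖D.shift (Λ' - Λ)‖ ^ 2 ≤ D.L ^ 2 * m * ‖Λ' - Λ‖ ^ 2 := by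
    have := pow_le_pow_left₀ (norm_nonneg _) (norm_shift_le hL hW (Λ' - Λ)) 2
    rwa [mul_pow, mul_pow, Real.sq_sqrt (by positivity)] at this
  have h3 := Finset.sum_le_sum fun i (_ : i ∈ Finset.univ) => h1 i
  rw [← Finset.mul_sum, ← rowMat_norm_sq, Finset.sum_add_distrib, ← Finset.mul_sum _ _ 2,
    ← Finset.mul_sum _ _ 2, ← rowMat_norm_sq] at h3
  simp only [Finset.sum_const, Finset.card_univ, Fintype.card_fin, nsmul_eq_mul] at h3
  linarith

/-- The old maximizers `S x Λ` compete at `(x', Λ')`. `Φ` is linear in `Λ`, so only the smoothness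
of `fᵢ` in `x` costs a quadratic term. -/
theorem IsResponse.le_phiReal (hm : 0 < m) (hfun : D.FunAssumption)
    {S : Vec n₁ → RowMat m n₂ → RowMat m n₂} (hS : D.IsResponse S) {x x' : Vec n₁}
    (hx : x ∈ effDom D.g) (hx' : x' ∈ effDom D.g) (Λ Λ' : RowMat m n₂) :
    D.phiReal x Λ (S x Λ) + inner ℝ (D.gradPX x (S x Λ)) (x' - x)
      + inner ℝ (D.gradPLam (S x Λ)) (Λ' - Λ) - D.L / 2 * ‖x' - x‖ ^ 2
      ≤ D.phiReal x' Λ' (S x' Λ') := by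
  have h0 : (m : ℝ) ≠ 0 := by positivity
  have h1 : ∀ i, D.f i (WithLp.toLp 2 (x, S x Λ i)) - (D.h (S x Λ i)).toReal
      - inner ℝ (D.shift Λ i) (S x Λ i) + inner ℝ (D.gradX i x (S x Λ i)) (x' - x)
      - inner ℝ (D.shift (Λ' - Λ) i) (S x Λ i) - D.L / 2 * ‖x' - x‖ ^ 2 ≤
      D.f i (WithLp.toLp 2 (x', S x' Λ' i)) - (D.h (S x' Λ' i)).toReal
      - inner ℝ (D.shift Λ' i) (S x' Λ' i) := by
    intro i
    have a1 := (hS x' hx' Λ' i).isMax hfun hx' (hS x hx Λ i).1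
    have a2 := (abs_le.1 (hfun.abs_sub_le_fst i hx hx' (hS x hx Λ i).1)).1
    rw [← shift_sub, PiLp.sub_apply, inner_sub_left]
    linarith
  have h2 := mul_le_mul_of_nonneg_left (Finset.sum_le_sum fun i (_ : i ∈ Finset.univ) => h1 i)
    (show 0 ≤ 1 / (m : ℝ) by positivity)
  rw [inner_gradPLam hm, gradPX, inner_smul_left, sum_inner, conj_trivial, phiReal, phiReal]
  refine le_trans (le_of_eq ?_) h2
  rw [rowMat_inner]
  simp only [Finset.sum_sub_distrib, Finset.sum_add_distrib, Finset.sum_const, Finset.card_univ,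
    Fintype.card_fin, nsmul_eq_mul]
  field_simp
  ring

/-- Linearize in `x` at the new maximizers, which are suboptimal for the old `(x, Λ)`. Replacing
them by the old ones in the linear terms costs their displacement times the size of the step, which
is quadratic because the maximizers are Lipschitz. -/
theorem IsResponse.phiReal_le (hm : 0 < m) (hfun : D.FunAssumption)
    (hW : specNorm (D.W - 1) ≤ 2)
    {S : Vec n₁ → RowMat m n₂ → RowMat m n₂} (hS : D.IsResponse S) {x x' : Vec n₁}
    (hx : x ∈ effDom D.g) (hx' : x' ∈ effDom D.g) (Λ Λ' : RowMat m n₂) :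
    D.phiReal x' Λ' (S x' Λ') ≤ D.phiReal x Λ (S x Λ) + inner ℝ (D.gradPX x (S x Λ)) (x' - x)
      + inner ℝ (D.gradPLam (S x Λ)) (Λ' - Λ) + D.L / 2 * ‖x' - x‖ ^ 2
      + 2 * D.L * D.kappa * (‖x' - x‖ ^ 2 + ‖Λ' - Λ‖ ^ 2) := by
  have h0 : (m : ℝ) ≠ 0 := by positivity
  have hL := hfun.L_pos
  have hμ := hfun.μ_pos
  have h1 : ∀ i, D.f i (WithLp.toLp 2 (x', S x' Λ' i)) - (D.h (S x' Λ' i)).toReal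
      - inner ℝ (D.shift Λ' i) (S x' Λ' i) ≤
      D.f i (WithLp.toLp 2 (x, S x Λ i)) - (D.h (S x Λ i)).toReal
      - inner ℝ (D.shift Λ i) (S x Λ i) + inner ℝ (D.gradX i x (S x Λ i)) (x' - x)
      - inner ℝ (D.shift (Λ' - Λ) i) (S x Λ i) + D.L / 2 * ‖x' - x‖ ^ 2
      + 2 / D.μ * (D.L ^ 2 * ‖x' - x‖ ^ 2 + ‖D.shift (Λ' - Λ) i‖ ^ 2) := by
    intro i
    have a1 := (hS x hx Λ i).isMax hfun hx (hS x' hx' Λ' i).1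
    have a2 := (abs_le.1 (hfun.abs_sub_le_fst i hx hx' (hS x' hx' Λ' i).1)).2
    have a3 := (hS x' hx' Λ' i).norm_sub_le hfun (hS x hx Λ i) hx' hx
    have a4 := hfun.norm_gradX_sub_le_snd i hx (hS x' hx' Λ' i).1 (hS x hx Λ i).1
    have a5 := real_inner_le_norm (D.gradX i x (S x' Λ' i) - D.gradX i x (S x Λ i)) (x' - x)
    have hσ : D.shift Λ' i = D.shift Λ i + D.shift (Λ' - Λ) i := by
      rw [← shift_sub, PiLp.sub_apply]
      abel
    rw [hσ, add_sub_cancel_left] at a3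
    rw [hσ, inner_add_left]
    generalize D.shift (Λ' - Λ) i = σ at a3 ⊢
    have a6 := real_inner_le_norm (-σ) (S x' Λ' i - S x Λ i)
    have a7 := mul_le_mul_of_nonneg_right a4 (norm_nonneg (x' - x))
    set s := ‖S x' Λ' i - S x Λ i‖
    set a := D.L * ‖x' - x‖ with ha
    set b := ‖σ‖ with hb
    -- The displacement `s` is at most `(a + b)/μ`, and `(a + b)² ≤ 2 (a² + b²)`.
    have a8 : s * (a + b) ≤ 2 / D.μ * (a ^ 2 + b ^ 2) := by
      have hab : 0 ≤ a + b := by positivity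
      have c1 : s ≤ (a + b) / D.μ := by
        rw [le_div_iff₀ hμ]
        linarith
      have c2 : s * (a + b) ≤ (a + b) / D.μ * (a + b) := mul_le_mul_of_nonneg_right c1 hab
      have c3 : 2 / D.μ * (a ^ 2 + b ^ 2) - (a + b) / D.μ * (a + b) = (a - b) ^ 2 / D.μ := by
        field_simp
        ring
      have c4 : 0 ≤ (a - b) ^ 2 / D.μ := by positivity
      linarith
    have e1 : D.L ^ 2 * ‖x' - x‖ ^ 2 = a ^ 2 := by rw [ha]; ring
    rw [norm_neg, inner_neg_left] at a6
    rw [e1]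
    simp only [inner_sub_left (D.gradX i x _), inner_sub_right σ] at a5 a6
    have a9 : D.L * s * ‖x' - x‖ = s * a := by rw [ha]; ring
    linarith
  have h2 := mul_le_mul_of_nonneg_left (Finset.sum_le_sum fun i (_ : i ∈ Finset.univ) => h1 i)
    (show 0 ≤ 1 / (m : ℝ) by positivity)
  have h3 : ‖D.shift (Λ' - Λ)‖ ^ 2 ≤ D.L ^ 2 * m * ‖Λ' - Λ‖ ^ 2 := by
    have := pow_le_pow_left₀ (norm_nonneg _) (norm_shift_le hL hW (Λ' - Λ)) 2
    rwa [mul_pow, mul_pow, Real.sq_sqrt (by positivity)] at this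
  have h4 : 1 / (m : ℝ) * (2 / D.μ * ‖D.shift (Λ' - Λ)‖ ^ 2) ≤
      1 / (m : ℝ) * (2 / D.μ * (D.L ^ 2 * m * ‖Λ' - Λ‖ ^ 2)) := by gcongr
  have e : 1 / (m : ℝ) * ∑ i, (D.f i (WithLp.toLp 2 (x, S x Λ i)) - (D.h (S x Λ i)).toReal
      - inner ℝ (D.shift Λ i) (S x Λ i) + inner ℝ (D.gradX i x (S x Λ i)) (x' - x)
      - inner ℝ (D.shift (Λ' - Λ) i) (S x Λ i) + D.L / 2 * ‖x' - x‖ ^ 2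
      + 2 / D.μ * (D.L ^ 2 * ‖x' - x‖ ^ 2 + ‖D.shift (Λ' - Λ) i‖ ^ 2)) =
      D.phiReal x Λ (S x Λ) + inner ℝ (D.gradPX x (S x Λ)) (x' - x)
      + inner ℝ (D.gradPLam (S x Λ)) (Λ' - Λ) + D.L / 2 * ‖x' - x‖ ^ 2
      + 2 * D.L * D.kappa * ‖x' - x‖ ^ 2 + 1 / (m : ℝ) * (2 / D.μ * ‖D.shift (Λ' - Λ)‖ ^ 2) := by
    rw [inner_gradPLam hm, gradPX, inner_smul_left, sum_inner, conj_trivial, phiReal, rowMat_inner,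
      rowMat_norm_sq, kappa]
    simp only [Finset.sum_sub_distrib, Finset.sum_add_distrib, Finset.sum_const, Finset.card_univ,
      Fintype.card_fin, nsmul_eq_mul, mul_add, Finset.mul_sum]
    simp only [← Finset.mul_sum]
    field_simp
    ring
  have e2 : 1 / (m : ℝ) * (2 / D.μ * (D.L ^ 2 * m * ‖Λ' - Λ‖ ^ 2))
      = 2 * D.L * D.kappa * ‖Λ' - Λ‖ ^ 2 := by
    rw [kappa]
    field_simp
  rw [e] at h2
  rw [e2] at h4
  have h5 : D.phiReal x' Λ' (S x' Λ') ≤ _ := h2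
  linarith

theorem IsResponse.hasGradOn (hm : 0 < m) (hfun : D.FunAssumption)
    (hW : specNorm (D.W - 1) ≤ 2)
    {S : Vec n₁ → RowMat m n₂ → RowMat m n₂} (hS : D.IsResponse S) {x : Vec n₁}
    (hx : x ∈ effDom D.g) (Λ : RowMat m n₂) :
    HasGradOn (fun u : WithLp 2 (Vec n₁ × RowMat m n₂) => D.P u.fst u.snd)
      (WithLp.toLp 2 (D.gradPX x (S x Λ), D.gradPLam (S x Λ)))
      {u | u.fst ∈ effDom D.g} (WithLp.toLp 2 (x, Λ)) := by
  have hL := hfun.L_pos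
  have hμ := hfun.μ_pos
  have hκ : 0 < D.kappa := div_pos hL hμ
  refine ⟨hx, fun u => D.phiReal u.fst u.snd (S u.fst u.snd), ?_, ?_⟩
  · filter_upwards [self_mem_nhdsWithin] with v hv
    exact hS.P_eq hm hfun hv v.snd
  · refine hasGradientWithinAt_of_abs_sub_le_sq (C := D.L / 2 + 2 * D.L * D.kappa) fun v hv => ?_
    have h1 := hS.phiReal_le hm hfun hW hx hv Λ v.snd
    have h2 := hS.le_phiReal hm hfun hx hv Λ v.snd
    have h3 : ‖v - WithLp.toLp 2 (x, Λ)‖ ^ 2 = ‖v.fst - x‖ ^ 2 + ‖v.snd - Λ‖ ^ 2 := by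
      rw [WithLp.prod_norm_sq_eq_of_L2]
      rfl
    have h4 : inner ℝ (WithLp.toLp 2 (D.gradPX x (S x Λ), D.gradPLam (S x Λ)))
        (v - WithLp.toLp 2 (x, Λ)) = inner ℝ (D.gradPX x (S x Λ)) (v.fst - x)
          + inner ℝ (D.gradPLam (S x Λ)) (v.snd - Λ) := by
      rw [WithLp.prod_inner_apply]
      rfl
    rw [h3, h4]
    have h5 : 0 ≤ D.L / 2 * ‖v.snd - Λ‖ ^ 2 := by positivity
    have h6 : 0 ≤ 2 * D.L * D.kappa * (‖v.fst - x‖ ^ 2 + ‖v.snd - Λ‖ ^ 2) := by positivity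
    change |D.phiReal v.fst v.snd (S v.fst v.snd) - D.phiReal x Λ (S x Λ) - _| ≤ _
    rw [abs_le]
    constructor <;> linarith

end Problem

/-! ### The proximal step on all rows at once. -/

section Prox

variable {m n : ℕ} {g : Vec n → EReal}

theorem IsClosedConvex.avg_mem (hm : 0 < m) (hg : IsClosedConvex g) {X : RowMat m n}
    (hX : ∀ i, X i ∈ effDom g) : avg X ∈ effDom g := by
  have h0 : (m : ℝ) ≠ 0 := by positivity
  rw [avg, Finset.smul_sum]
  exact hg.convex_effDom.sum_mem (fun _ _ => by positivity) (by simp [h0]) fun i _ => hX i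

theorem IsClosedConvex.toReal_avg_le (hm : 0 < m) (hg : IsClosedConvex g) {X : RowMat m n}
    (hX : ∀ i, X i ∈ effDom g) : (m : ℝ) * (g (avg X)).toReal ≤ ∑ i, (g (X i)).toReal := by
  have h0 : (0 : ℝ) < m := by positivity
  have h := hg.convexOn.map_sum_le (t := Finset.univ) (w := fun _ : Fin m => 1 / (m : ℝ))
    (p := fun i => X i) (fun _ _ => by positivity) (by simp [h0.ne']) fun i _ => hX i
  rw [← Finset.smul_sum, ← Finset.smul_sum, smul_eq_mul] at h
  have := mul_le_mul_of_nonneg_left h h0.le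
  rwa [← mul_assoc, mul_one_div_cancel h0.ne', one_mul] at this

/-- Sum the variational inequalities of the rows at a common test point, and use Jensen's inequality
to replace the average of `g` by `g` at the average. -/
theorem IsClosedConvex.isProx_rows (hm : 0 < m) (hg : IsClosedConvex g) {η : ℝ} (hη : 0 < η)
    {B X : RowMat m n} (h : ∀ i, IsProx (fun u => (η : EReal) * g u) (B i) (X i)) {u : Vec n}
    (hu : u ∈ effDom g) :
    η * ((m : ℝ) * (g (avg X)).toReal) + inner ℝ (B - X) (rep m u - X)
      ≤ η * ((m : ℝ) * (g u).toReal) := by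
  have h1 := mul_le_mul_of_nonneg_left
    (hg.toReal_avg_le hm fun i => hg.mem_effDom_of_isProx hη (h i)) hη.le
  have h2 := Finset.sum_le_sum fun i (_ : i ∈ Finset.univ) => hg.isProx_variational hη (h i) hu
  rw [Finset.sum_add_distrib, ← Finset.mul_sum] at h2
  simp only [Finset.sum_const, Finset.card_univ, Fintype.card_fin, nsmul_eq_mul] at h2
  rw [rowMat_inner]
  simp only [PiLp.sub_apply, rep_apply]
  linarith

/-- With the average itself as test point the values of `g` cancel, leaving `‖X_⊥‖² ≤ ⟨B_⊥, X_⊥⟩`.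
-/
theorem IsClosedConvex.norm_perp_prox_le (hm : 0 < m) (hg : IsClosedConvex g) {η : ℝ}
    (hη : 0 < η) {B X : RowMat m n}
    (h : ∀ i, IsProx (fun u => (η : EReal) * g u) (B i) (X i)) : ‖perp X‖ ≤ ‖perp B‖ := by
  have h1 := hg.isProx_rows hm hη h (hg.avg_mem hm fun i => hg.mem_effDom_of_isProx hη (h i))
  have e : rep m (avg X) - X = -perp X := by rw [perp, neg_sub]
  rw [e, inner_neg_right, inner_perp_perp hm, perp_sub, inner_sub_left,
    real_inner_self_eq_norm_sq] at h1
  have h2 := real_inner_le_norm (perp B) (perp X)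
  rcases (norm_nonneg (perp X)).eq_or_lt with h0 | h0
  · rw [← h0]
    exact norm_nonneg _
  · refine le_of_mul_le_mul_right ?_ h0
    nlinarith

end Prox

/-! ### One-step decrease of the Lyapunov function. -/

namespace Problem

variable {m n₁ n₂ : ℕ} {D : Problem m n₁ n₂}

/-- The rows are the local partial gradients `∇ₓfᵢ(xᵢ, yᵢ)`. -/
def gradMat (D : Problem m n₁ n₂) (X : RowMat m n₁) (Y : RowMat m n₂) : RowMat m n₁ :=
  WithLp.toLp 2 fun i => D.gradX i (X i) (Y i)

theorem avg_gradMat_rep (x : Vec n₁) (Y : RowMat m n₂) :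
    avg (D.gradMat (rep m x) Y) = D.gradPX x Y := rfl

/-- The rows of `Y` solve the local maximization problems with accuracy `μ e`. -/
def IsApproxResponse (D : Problem m n₁ n₂) (e : ℝ) (X : RowMat m n₁) (Λ Y : RowMat m n₂) : Prop :=
  ∀ i, ∃ ξ, ‖ξ‖ ≤ D.μ * e ∧ D.IsOptimalAt i (X i) (D.shift Λ i + ξ) (Y i)

theorem IsResponse.isApproxResponse {S : Vec n₁ → RowMat m n₂ → RowMat m n₂}
    (hS : D.IsResponse S) {x : Vec n₁} (hx : x ∈ effDom D.g) (Λ : RowMat m n₂) :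
    D.IsApproxResponse 0 (rep m x) Λ (S x Λ) :=
  fun i => ⟨0, by simp, by simpa using hS x hx Λ i⟩

theorem IsApproxResponse.mem {e : ℝ} {X : RowMat m n₁} {Λ Y : RowMat m n₂}
    (h : D.IsApproxResponse e X Λ Y) (i : Fin m) : Y i ∈ effDom D.h := by
  obtain ⟨ξ, _, hξ⟩ := h i
  exact hξ.1

theorem IsApproxResponse.norm_sub_sq_le (hfun : D.FunAssumption) (hW : specNorm (D.W - 1) ≤ 2)
    {e e' : ℝ} {X X' : RowMat m n₁} {Λ Λ' Y Y' : RowMat m n₂}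
    (h : D.IsApproxResponse e X Λ Y) (h' : D.IsApproxResponse e' X' Λ' Y')
    (hX : ∀ i, X i ∈ effDom D.g) (hX' : ∀ i, X' i ∈ effDom D.g) :
    ‖Y - Y'‖ ^ 2 ≤ 2 * D.kappa ^ 2 * ‖X - X'‖ ^ 2 + 4 * D.kappa ^ 2 * m * ‖Λ - Λ'‖ ^ 2
      + 4 * m * (e + e') ^ 2 := by
  have hL := hfun.L_pos
  have hμ := hfun.μ_pos
  have h1 : ∀ i, ‖(Y - Y') i‖ ^ 2 ≤ 2 * D.kappa ^ 2 * ‖(X - X') i‖ ^ 2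
      + 4 / D.μ ^ 2 * ‖D.shift (Λ - Λ') i‖ ^ 2 + 4 * (e + e') ^ 2 := by
    intro i
    obtain ⟨ξ, hξ, ho⟩ := h i
    obtain ⟨ξ', hξ', ho'⟩ := h' i
    have a1 := ho.norm_sub_le hfun ho' (hX i) (hX' i)
    have a2 : ‖D.shift Λ i + ξ - (D.shift Λ' i + ξ')‖ ≤
        ‖D.shift (Λ - Λ') i‖ + D.μ * (e + e') := by
      have e1 : D.shift Λ i + ξ - (D.shift Λ' i + ξ') = D.shift (Λ - Λ') i + (ξ - ξ') := by
        rw [← shift_sub, PiLp.sub_apply]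
        abel
      rw [e1]
      refine (norm_add_le _ _).trans ?_
      have := norm_sub_le ξ ξ'
      linarith
    simp only [PiLp.sub_apply]
    generalize ‖D.shift (Λ - Λ') i‖ = b at a2 ⊢
    generalize ‖X i - X' i‖ = a at a1 ⊢
    have a3 : ‖Y i - Y' i‖ ≤ D.kappa * a + (b / D.μ + (e + e')) := by
      refine le_of_mul_le_mul_left ?_ hμ
      have : D.μ * (D.kappa * a + (b / D.μ + (e + e'))) = D.L * a + (b + D.μ * (e + e')) := by
        rw [kappa]
        field_simp
      linarith
    -- The constants 2, 4, 4 come from applying `(u + v)² ≤ 2u² + 2v²` twice.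
    have a4 := pow_le_pow_left₀ (norm_nonneg _) a3 2
    have e2 : 4 / D.μ ^ 2 * b ^ 2 = 4 * (b / D.μ) ^ 2 := by ring
    rw [e2]
    linarith [sq_nonneg (D.kappa * a - (b / D.μ + (e + e'))), sq_nonneg (b / D.μ - (e + e'))]
  have h2 : ‖D.shift (Λ - Λ')‖ ^ 2 ≤ D.L ^ 2 * m * ‖Λ - Λ'‖ ^ 2 := by
    have := pow_le_pow_left₀ (norm_nonneg _) (norm_shift_le hL hW (Λ - Λ')) 2
    rwa [mul_pow, mul_pow, Real.sq_sqrt (by positivity)] at this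
  have h3 := Finset.sum_le_sum fun i (_ : i ∈ Finset.univ) => h1 i
  rw [← rowMat_norm_sq, Finset.sum_add_distrib, Finset.sum_add_distrib, ← Finset.mul_sum,
    ← Finset.mul_sum, ← rowMat_norm_sq, ← rowMat_norm_sq] at h3
  simp only [Finset.sum_const, Finset.card_univ, Fintype.card_fin, nsmul_eq_mul] at h3
  have h4 : 4 / D.μ ^ 2 * ‖D.shift (Λ - Λ')‖ ^ 2 ≤ 4 / D.μ ^ 2 * (D.L ^ 2 * m * ‖Λ - Λ'‖ ^ 2) := by
    gcongr
  have e3 : 4 / D.μ ^ 2 * (D.L ^ 2 * m * ‖Λ - Λ'‖ ^ 2) = 4 * D.kappa ^ 2 * m * ‖Λ - Λ'‖ ^ 2 := by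
    rw [kappa]
    field_simp
  linarith

theorem FunAssumption.norm_gradMat_sub_sq_le (hfun : D.FunAssumption)
    {X X' : RowMat m n₁} {Y Y' : RowMat m n₂} (hX : ∀ i, X i ∈ effDom D.g)
    (hX' : ∀ i, X' i ∈ effDom D.g) (hY : ∀ i, Y i ∈ effDom D.h) (hY' : ∀ i, Y' i ∈ effDom D.h) :
    ‖D.gradMat X Y - D.gradMat X' Y'‖ ^ 2 ≤ D.L ^ 2 * (‖X - X'‖ ^ 2 + ‖Y - Y'‖ ^ 2) := by
  rw [rowMat_norm_sq, rowMat_norm_sq, rowMat_norm_sq, ← Finset.sum_add_distrib, Finset.mul_sum]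
  exact Finset.sum_le_sum fun i _ => hfun.norm_gradX_sub_sq_le i (hX i) (hY i) (hX' i) (hY' i)

theorem gradPLam_sub (Y Z : RowMat m n₂) :
    D.gradPLam (Y - Z) = D.gradPLam Y - D.gradPLam Z := by
  rw [gradPLam, gradPLam, gradPLam, matMul_sub, smul_sub]
  abel

theorem norm_gradPLam_le (hL : 0 < D.L) (hW : specNorm (D.W - 1) ≤ 2) (Y : RowMat m n₂) :
    ‖D.gradPLam Y‖ ≤ D.L * (‖Y‖ / √(m : ℝ)) := by
  rw [gradPLam, norm_neg, norm_smul, Real.norm_of_nonneg (by positivity)]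
  have h1 := (norm_matMul_le (D.W - 1) Y).trans (mul_le_mul_of_nonneg_right hW (norm_nonneg Y))
  refine (mul_le_mul_of_nonneg_left h1 (by positivity)).trans (le_of_eq ?_)
  ring

theorem MixingAssumption.row_sum {𝒢 : SimpleGraph (Fin m)} (hmix : D.MixingAssumption 𝒢)
    (i : Fin m) : ∑ j, D.W i j = 1 := by
  have h : (fun _ => (1 : ℝ)) ∈ LinearMap.ker (Matrix.toLin' (D.W - 1)) := by
    rw [hmix.null_space]
    exact Submodule.mem_span_singleton_self _
  rw [LinearMap.mem_ker, Matrix.toLin'_apply, Matrix.sub_mulVec, Matrix.one_mulVec] at h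
  have := congrFun h i
  simp only [Matrix.mulVec, dotProduct, mul_one, Pi.sub_apply, Pi.zero_apply] at this
  linarith

theorem IsResponse.exists_le_phiReal_add (hm : 0 < m) (hfun : D.FunAssumption)
    {𝒢 : SimpleGraph (Fin m)} (hmix : D.MixingAssumption 𝒢)
    {S : Vec n₁ → RowMat m n₂ → RowMat m n₂} (hS : D.IsResponse S) :
    ∃ M : ℝ, ∀ x ∈ effDom D.g, ∀ Λ, M ≤ D.phiReal x Λ (S x Λ) + (D.g x).toReal := by
  obtain ⟨x₀, ⟨M, hM⟩, hmin⟩ := hfun.solution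
  refine ⟨M, fun x hx Λ => ?_⟩
  have h1 := hmin x
  rw [hM] at h1
  have h2 := h1.trans (add_le_add_left (p_le_P hm hfun x Λ hmix.row_sum) (D.g x))
  rwa [hS.P_eq hm hfun hx, ← hfun.g_convex.coe_toReal hx, ← EReal.coe_add, EReal.coe_le_coe_iff]
    at h2

/-- The constant `√(1 + 6κ²)`. -/
def smoothConst (D : Problem m n₁ n₂) : ℝ := √(1 + 6 * D.kappa ^ 2)

/-- The Lyapunov function of the method. -/
def lyapunov (D : Problem m n₁ n₂) (S : Vec n₁ → RowMat m n₂ → RowMat m n₂) (X : RowMat m n₁)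
    (Λ : RowMat m n₂) (V : RowMat m n₁) : ℝ :=
  (D.phiReal (avg X) Λ (S (avg X) Λ) + (D.g (avg X)).toReal) / D.L
    + 10 * D.smoothConst / (1 - D.rho) ^ 3 * (‖perp X‖ / √(m : ℝ)) ^ 2
    + 1 / (D.smoothConst * (1 - D.rho)) * (‖perp V‖ / (D.L * √(m : ℝ))) ^ 2

theorem smoothConst_pos : 0 < D.smoothConst := by
  unfold smoothConst
  positivity

theorem smoothConst_sq : D.smoothConst ^ 2 = 1 + 6 * D.kappa ^ 2 := Real.sq_sqrt (by positivity)

theorem rho_nonneg : 0 ≤ D.rho := specNorm_nonneg _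

theorem FunAssumption.kappa_pos (hfun : D.FunAssumption) : 0 < D.kappa :=
  div_pos hfun.L_pos hfun.μ_pos

theorem FunAssumption.etaX_pos (hfun : D.FunAssumption) (hρ : D.rho < 1) : 0 < D.etaX := by
  have hL := hfun.L_pos
  have hr : 0 < 1 - D.rho := by linarith
  unfold etaX
  positivity

theorem FunAssumption.etaLam_pos (hfun : D.FunAssumption) (hρ : D.rho < 1) : 0 < D.etaLam := by
  have hL := hfun.L_pos
  have hκ := hfun.kappa_pos
  have hr : 0 < 1 - D.rho := by linarith
  unfold etaLam
  positivity

theorem inv_L_mul_etaX (hfun : D.FunAssumption) (hρ : D.rho < 1) :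
    1 / (D.L * D.etaX) = 5 * D.smoothConst / (1 - D.rho) ^ 2 := by
  have hL := hfun.L_pos
  have hr : 0 < 1 - D.rho := by linarith
  have hs := D.smoothConst_pos
  rw [etaX, ← smoothConst]
  field_simp

theorem L_mul_etaX (hfun : D.FunAssumption) :
    D.L * D.etaX = (1 - D.rho) ^ 2 / (5 * D.smoothConst) := by
  have hL := hfun.L_pos
  have hs := D.smoothConst_pos
  rw [etaX, ← smoothConst]
  field_simp

theorem inv_L_mul_etaLam (hfun : D.FunAssumption) (hρ : D.rho < 1) :
    1 / (D.L * D.etaLam) = (9 * D.kappa + 2) / (1 - D.rho) ^ 2 := by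
  have hL := hfun.L_pos
  have hκ := hfun.kappa_pos
  have hr : 0 < 1 - D.rho := by linarith
  rw [etaLam]
  field_simp

variable {𝒢 : SimpleGraph (Fin m)}

/-- Take the old average as common test point and split the inner product into average and
disagreement parts. The first is a proximal gradient step for the average; the second is controlled
by mixing. -/
theorem g_avg_step (hm : 0 < m) (hfun : D.FunAssumption) (hmix : D.MixingAssumption 𝒢)
    {X X' V : RowMat m n₁} {η : ℝ} (hη : 0 < η) (hX : ∀ i, X i ∈ effDom D.g)
    (hprox : ∀ i, IsProx (fun u => (η : EReal) * D.g u) ((matMul D.W X - η • V) i) (X' i)) :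
    η * m * ((D.g (avg X')).toReal - (D.g (avg X)).toReal) ≤
      -(m * ‖avg X' - avg X‖ ^ 2) - η * m * inner ℝ (avg V) (avg X' - avg X)
      + D.rho * ‖perp X‖ * ‖perp X'‖ - ‖perp X'‖ ^ 2 + η * (‖perp V‖ * ‖perp X'‖) := by
  have h1 := hfun.g_convex.isProx_rows hm hη hprox (hfun.g_convex.avg_mem hm hX)
  rw [inner_eq_avg_add_perp hm, perp_sub, perp_sub, perp_sub, perp_rep hm, avg_sub, avg_sub,
    avg_sub, avg_matMul hmix.column_sum, avg_rep hm, perp_smul, avg_smul] at h1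
  have e1 : inner ℝ (avg X - η • avg V - avg X') (avg X - avg X')
      = ‖avg X' - avg X‖ ^ 2 + η * inner ℝ (avg V) (avg X' - avg X) := by
    have : avg X - η • avg V - avg X' = -((avg X' - avg X) + η • avg V) := by abel
    rw [this, ← neg_sub (avg X') (avg X), inner_neg_neg, inner_add_left, inner_smul_left,
      real_inner_self_eq_norm_sq]
    rfl
  have e2 : inner ℝ (perp (matMul D.W X) - η • perp V - perp X') (0 - perp X')
      = ‖perp X'‖ ^ 2 + η * inner ℝ (perp V) (perp X')
        - inner ℝ (perp (matMul D.W X)) (perp X') := by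
    rw [zero_sub, inner_neg_right, inner_sub_left, inner_sub_left, inner_smul_left,
      real_inner_self_eq_norm_sq, conj_trivial]
    ring
  rw [e1, e2] at h1
  have h2 := real_inner_le_norm (perp (matMul D.W X)) (perp X')
  have h3 := (abs_le.1 (abs_real_inner_le_norm (perp V) (perp X'))).1
  have h4 := mul_le_mul_of_nonneg_right
    (norm_perp_matMul_le hm hmix.column_sum hmix.row_sum X) (norm_nonneg (perp X'))
  have h5 := mul_le_mul_of_nonneg_left h3 hη.le
  change _ ≤ D.rho * ‖perp X‖ * ‖perp X'‖ at h4
  linarith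

theorem norm_perp_step_x (hm : 0 < m) (hfun : D.FunAssumption) (hmix : D.MixingAssumption 𝒢)
    {X X' V : RowMat m n₁} {η : ℝ} (hη : 0 < η)
    (hprox : ∀ i, IsProx (fun u => (η : EReal) * D.g u) ((matMul D.W X - η • V) i) (X' i)) :
    ‖perp X'‖ ≤ D.rho * ‖perp X‖ + η * ‖perp V‖ := by
  refine (hfun.g_convex.norm_perp_prox_le hm hη hprox).trans ?_
  rw [perp_sub, perp_smul]
  refine (norm_sub_le _ _).trans ?_
  rw [norm_smul, Real.norm_of_nonneg hη.le]
  have := norm_perp_matMul_le hm hmix.column_sum hmix.row_sum X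
  change _ ≤ D.rho * ‖perp X‖ at this
  linarith

theorem norm_perp_step_v (hm : 0 < m) (hmix : D.MixingAssumption 𝒢) (V G G' : RowMat m n₁) :
    ‖perp (matMul D.W V + G' - G)‖ ≤ D.rho * ‖perp V‖ + ‖G' - G‖ := by
  rw [add_sub_assoc, perp_add]
  refine (norm_add_le _ _).trans ?_
  have := norm_perp_matMul_le hm hmix.column_sum hmix.row_sum V
  change _ ≤ D.rho * ‖perp V‖ at this
  have := norm_perp_le hm (G' - G)
  linarith

/-- `S (avg X) Λ` is an exact response at the consensus point and `Y` an inexact one at `X`, with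
the same `Λ`. They differ only through the disagreement of `X` and the tolerance. -/
theorem norm_gradPX_sub_avg_sq_le (hm : 0 < m) (hfun : D.FunAssumption)
    (hW : specNorm (D.W - 1) ≤ 2) {S : Vec n₁ → RowMat m n₂ → RowMat m n₂} (hS : D.IsResponse S)
    {X : RowMat m n₁} {Λ Y : RowMat m n₂} {e : ℝ} (hX : ∀ i, X i ∈ effDom D.g)
    (hY : D.IsApproxResponse e X Λ Y) :
    m * ‖D.gradPX (avg X) (S (avg X) Λ) - avg (D.gradMat X Y)‖ ^ 2 ≤
        D.L ^ 2 * ((1 + 2 * D.kappa ^ 2) * ‖perp X‖ ^ 2 + 4 * m * e ^ 2) ∧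
      ‖S (avg X) Λ - Y‖ ^ 2 ≤ 2 * D.kappa ^ 2 * ‖perp X‖ ^ 2 + 4 * m * e ^ 2 := by
  have hx := hfun.g_convex.avg_mem hm hX
  have hSa := hS.isApproxResponse hx Λ
  have h1 := hSa.norm_sub_sq_le hfun hW hY (fun _ => hx) hX
  have h2 := hfun.norm_gradMat_sub_sq_le (X := rep m (avg X)) (fun _ => hx) hX hSa.mem hY.mem
  have h3 := norm_avg_sq_le hm (D.gradMat (rep m (avg X)) (S (avg X) Λ) - D.gradMat X Y)
  rw [avg_sub, avg_gradMat_rep] at h3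
  have e1 : ‖rep m (avg X) - X‖ = ‖perp X‖ := by rw [perp, norm_sub_rev]
  rw [e1, sub_self, norm_zero, zero_add] at h1
  rw [e1] at h2
  have h4 : ‖S (avg X) Λ - Y‖ ^ 2 ≤ 2 * D.kappa ^ 2 * ‖perp X‖ ^ 2 + 4 * m * e ^ 2 := by linarith
  refine ⟨h3.trans (h2.trans ?_), h4⟩
  refine mul_le_mul_of_nonneg_left ?_ (sq_nonneg _)
  linarith

set_option maxHeartbeats 1000000 in
theorem lyapunov_le (hm : 0 < m) (hfun : D.FunAssumption) (hmix : D.MixingAssumption 𝒢)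
    {S : Vec n₁ → RowMat m n₂ → RowMat m n₂} (hS : D.IsResponse S)
    {X X' V V' : RowMat m n₁} {Λ Λ' Y Y' : RowMat m n₂} {e e' : ℝ} (he : 0 ≤ e) (he' : 0 ≤ e')
    (hX : ∀ i, X i ∈ effDom D.g) (hX' : ∀ i, X' i ∈ effDom D.g)
    (hY : D.IsApproxResponse e X Λ Y) (hY' : D.IsApproxResponse e' X' Λ' Y')
    (hprox : ∀ i, IsProx (fun u => (D.etaX : EReal) * D.g u)
      ((matMul D.W X - D.etaX • V) i) (X' i))
    (hΛ : Λ' - Λ = -(D.etaLam • D.gradPLam Y))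
    (hV : V' = matMul D.W V + D.gradMat X' Y' - D.gradMat X Y)
    (hVavg : avg V = avg (D.gradMat X Y)) :
    D.lyapunov S X' Λ' V' ≤ D.lyapunov S X Λ V
      - (2 * ‖avg X' - avg X‖ ^ 2 + ‖Λ' - Λ‖ ^ 2 + (‖perp X‖ / √(m : ℝ)) ^ 2
        + 3 / 25 / D.smoothConst * (‖perp V‖ / (D.L * √(m : ℝ))) ^ 2)
      + 8 / (1 - D.rho) ^ 2 * (e + e') ^ 2 := by
  have hL := hfun.L_pos
  have hW := hmix.norm_le_two
  have hρ := hmix.rho_lt_one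
  have hηx := hfun.etaX_pos hρ
  have hηl := hfun.etaLam_pos hρ
  have hm0 : (0 : ℝ) < m := by exact_mod_cast hm
  have hM : 0 < √(m : ℝ) := Real.sqrt_pos.2 hm0
  have hM2 : √(m : ℝ) ^ 2 = m := Real.sq_sqrt hm0.le
  have hx := hfun.g_convex.avg_mem hm hX
  have hx' := hfun.g_convex.avg_mem hm hX'
  unfold lyapunov
  obtain ⟨hN, hy⟩ := norm_gradPX_sub_avg_sq_le hm hfun hW hS hX hY
  have hYY := hY'.norm_sub_sq_le hfun hW hY hX' hX
  have hGG := hfun.norm_gradMat_sub_sq_le hX' hX hY'.mem hY.mem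
  have hg := g_avg_step hm hfun hmix hηx hX hprox
  have hP := hS.phiReal_le hm hfun hW hx hx' Λ Λ'
  have hpX := norm_perp_step_x hm hfun hmix hηx hprox
  have hpV := norm_perp_step_v hm hmix V (D.gradMat X Y) (D.gradMat X' Y')
  rw [← hV] at hpV
  set φ := D.phiReal (avg X) Λ (S (avg X) Λ)
  set φ' := D.phiReal (avg X') Λ' (S (avg X') Λ')
  set N := D.gradPX (avg X) (S (avg X) Λ) - avg (D.gradMat X Y) with hNdef
  set SY := S (avg X) Λ - Y with hSY
  set dx := avg X' - avg X with hdx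
  set dΛ := Λ' - Λ with hdΛ
  set a := ‖perp X‖ with ha
  set a' := ‖perp X'‖ with ha'
  set b := ‖perp V‖ with hb
  set b' := ‖perp V'‖ with hb'
  set dG := ‖D.gradMat X' Y' - D.gradMat X Y‖ with hdG
  -- `lyapunov_step` has a single error parameter; `e + e'` serves for the old tolerance as well as
  -- for both together.
  have hee : e ^ 2 ≤ (e + e') ^ 2 := pow_le_pow_left₀ he (by linarith) 2
  have hXX : ‖X' - X‖ ^ 2 ≤ m * ‖dx‖ ^ 2 + 2 * a ^ 2 + 2 * a' ^ 2 := by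
    rw [norm_sq_eq_avg_add_perp hm, avg_sub, perp_sub]
    have h1 := pow_le_pow_left₀ (norm_nonneg _) (norm_sub_le (perp X') (perp X)) 2
    nlinarith [sq_nonneg (a - a')]
  -- Gradient tracking enters here: the direction `avg V` used by the step is `∇ₓP` up to the error
  -- `N`.
  have hPX : inner ℝ (D.gradPX (avg X) (S (avg X) Λ)) dx ≤
      inner ℝ (avg V) dx + ‖N‖ * ‖dx‖ := by
    have h1 : D.gradPX (avg X) (S (avg X) Λ) = avg V + N := by
      rw [hNdef, hVavg]
      abel
    rw [h1, inner_add_left]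
    linarith [real_inner_le_norm N dx]
  -- Since `dΛ = -ηλ ∇_ΛP` with `Y` in place of the exact maximizers, the linear term yields the
  -- decrease `‖dΛ‖²/ηλ`, and `SY` accounts for the replacement.
  have hPL : inner ℝ (D.gradPLam (S (avg X) Λ)) dΛ ≤
      D.L * (‖SY‖ / √(m : ℝ)) * ‖dΛ‖ - ‖dΛ‖ ^ 2 / D.etaLam := by
    have h1 : D.gradPLam (S (avg X) Λ) = D.gradPLam SY + D.gradPLam Y := by
      rw [hSY, gradPLam_sub]
      abel
    have h2 : D.gradPLam Y = -((1 / D.etaLam) • dΛ) := by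
      rw [hΛ, smul_neg, neg_neg, smul_smul, one_div_mul_cancel hηl.ne', one_smul]
    have h3 := mul_le_mul_of_nonneg_right (norm_gradPLam_le hL hW SY) (norm_nonneg dΛ)
    rw [h1, inner_add_left]
    rw [h2, inner_neg_left, inner_smul_left, real_inner_self_eq_norm_sq, conj_trivial]
    have h4 := real_inner_le_norm (D.gradPLam SY) dΛ
    have e1 : ‖dΛ‖ ^ 2 / D.etaLam = 1 / D.etaLam * ‖dΛ‖ ^ 2 := by ring
    rw [e1]
    linarith
  have ha0 : 0 ≤ a := norm_nonneg _
  have ha0' : 0 ≤ a' := norm_nonneg _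
  have hb0 : 0 ≤ b := norm_nonneg _
  have hb0' : 0 ≤ b' := norm_nonneg _
  clear_value N SY dx dΛ a a' b b' dG
  have key := lyapunov_step (r := 1 - D.rho) (κ := D.kappa) (s := D.smoothConst)
    (α := a / √(m : ℝ)) (α' := a' / √(m : ℝ)) (β := b / (D.L * √(m : ℝ)))
    (β' := b' / (D.L * √(m : ℝ))) (D := ‖dx‖) (E := ‖dΛ‖) (e := e + e')
    (ξ := dG / (D.L * √(m : ℝ))) (N := ‖N‖ / D.L) (y := ‖SY‖ / √(m : ℝ))
    (Δ := (φ' + (D.g (avg X')).toReal) / D.L - (φ + (D.g (avg X)).toReal) / D.L)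
    (by linarith) (by linarith [D.rho_nonneg]) hfun.kappa_pos D.smoothConst_pos D.smoothConst_sq
    (by positivity) (by positivity) (by positivity) (by positivity) ?_ ?_ ?_ ?_ ?_ ?_
  · linarith
  · rw [← L_mul_etaX hfun, sub_sub_cancel, div_le_iff₀ hM]
    refine hpX.trans (le_of_eq ?_)
    field_simp
  · rw [sub_sub_cancel, div_le_iff₀ (by positivity)]
    refine hpV.trans (le_of_eq ?_)
    field_simp
  · rw [div_pow, div_pow, div_pow, mul_pow, hM2, div_le_iff₀ (by positivity)]
    refine hGG.trans ?_
    have e1 : ((1 + 2 * D.kappa ^ 2) * (‖dx‖ ^ 2 + 2 * (a ^ 2 / m) + 2 * (a' ^ 2 / m))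
        + 4 * D.kappa ^ 2 * ‖dΛ‖ ^ 2 + 4 * (e + e') ^ 2) * (D.L ^ 2 * m)
        = D.L ^ 2 * ((1 + 2 * D.kappa ^ 2) * (m * ‖dx‖ ^ 2 + 2 * a ^ 2 + 2 * a' ^ 2)
          + 4 * D.kappa ^ 2 * m * ‖dΛ‖ ^ 2 + 4 * m * (e + e') ^ 2) := by
      field_simp
    rw [e1]
    have h1 : (1 + 2 * D.kappa ^ 2) * ‖X' - X‖ ^ 2 ≤
      (1 + 2 * D.kappa ^ 2) * (m * ‖dx‖ ^ 2 + 2 * a ^ 2 + 2 * a' ^ 2) := by gcongr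
    rw [add_comm e' e] at hYY
    refine mul_le_mul_of_nonneg_left ?_ (sq_nonneg _)
    linarith
  · rw [div_pow, div_pow, hM2, div_le_iff₀ (by positivity)]
    refine le_of_mul_le_mul_left (hN.trans ?_) hm0
    have h1 : D.L ^ 2 * (4 * m * e ^ 2) ≤ D.L ^ 2 * (4 * m * (e + e') ^ 2) := by gcongr
    have e1 : (m : ℝ) * (((1 + 2 * D.kappa ^ 2) * (a ^ 2 / m) + 4 * (e + e') ^ 2) * D.L ^ 2)
        = D.L ^ 2 * ((1 + 2 * D.kappa ^ 2) * a ^ 2) + D.L ^ 2 * (4 * m * (e + e') ^ 2) := by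
      field_simp
    rw [e1]
    linarith
  · rw [div_pow, div_pow, hM2, div_le_iff₀ hm0]
    refine hy.trans ?_
    have h1 : 4 * m * e ^ 2 ≤ 4 * m * (e + e') ^ 2 := by gcongr
    have e1 : (2 * D.kappa ^ 2 * (a ^ 2 / m) + 4 * (e + e') ^ 2) * m
        = 2 * D.kappa ^ 2 * a ^ 2 + 4 * m * (e + e') ^ 2 := by
      field_simp
    rw [e1]
    linarith
  · rw [← inv_L_mul_etaX hfun hρ, ← inv_L_mul_etaLam hfun hρ, ← sub_div, div_le_iff₀ hL,
      sub_sub_cancel]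
    have hg2 : (D.g (avg X')).toReal - (D.g (avg X)).toReal ≤
        -(‖dx‖ ^ 2 / D.etaX) - inner ℝ (avg V) dx
        + (D.rho * a * a' - a' ^ 2) / (D.etaX * m) + b * a' / m := by
      have h1 : 0 < D.etaX * m := by positivity
      refine le_of_mul_le_mul_left (hg.trans (le_of_eq ?_)) h1
      field_simp
      ring
    have e1 : (‖N‖ / D.L * ‖dx‖ + ‖SY‖ / √(m : ℝ) * ‖dΛ‖
          + b / (D.L * √(m : ℝ)) * (a' / √(m : ℝ)) - 1 / (D.L * D.etaX) * ‖dx‖ ^ 2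
          - 1 / (D.L * D.etaX) * ((a' / √(m : ℝ)) ^ 2
            - D.rho * (a / √(m : ℝ)) * (a' / √(m : ℝ)))
          - 1 / (D.L * D.etaLam) * ‖dΛ‖ ^ 2 + ‖dx‖ ^ 2 / 2
          + 2 * D.kappa * (‖dx‖ ^ 2 + ‖dΛ‖ ^ 2)) * D.L
        = ‖N‖ * ‖dx‖ + D.L * (‖SY‖ / √(m : ℝ)) * ‖dΛ‖ + b * a' / m - ‖dx‖ ^ 2 / D.etaX
          + (D.rho * a * a' - a' ^ 2) / (D.etaX * m) - ‖dΛ‖ ^ 2 / D.etaLam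
          + D.L / 2 * ‖dx‖ ^ 2 + 2 * D.L * D.kappa * (‖dx‖ ^ 2 + ‖dΛ‖ ^ 2) := by
      generalize √(m : ℝ) = q at hM hM2 ⊢
      rw [← hM2]
      field_simp
      ring
    rw [e1]
    linarith

end Problem

/-! ### The iterates: tracking invariant, vanishing increments, continuity of the gradient. -/

namespace Problem

variable {m n₁ n₂ : ℕ} {D : Problem m n₁ n₂} {𝒢 : SimpleGraph (Fin m)}
  {ηx ηlam : ℝ} {δ : ℕ → ℝ} {X : ℕ → RowMat m n₁} {Λ Y : ℕ → RowMat m n₂} {V : ℕ → RowMat m n₁}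

theorem IsDGDMax.isProx (hrun : D.IsDGDMax ηx ηlam δ X Λ Y V) (t : ℕ) (i : Fin m) :
    IsProx (fun u => (ηx : EReal) * D.g u) ((matMul D.W (X t) - ηx • V t) i) (X (t + 1) i) :=
  hrun.step_x t i

theorem IsDGDMax.mem (hrun : D.IsDGDMax ηx ηlam δ X Λ Y V) (hfun : D.FunAssumption)
    (hη : 0 < ηx) (t : ℕ) (i : Fin m) : X t i ∈ effDom D.g := by
  cases t with
  | zero =>
    obtain ⟨x₀, hx₀, h⟩ := hrun.init_x
    rw [h i]
    exact hx₀
  | succ t => exact hfun.g_convex.mem_effDom_of_isProx hη (hrun.isProx t i)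

theorem IsDGDMax.V_succ (hrun : D.IsDGDMax ηx ηlam δ X Λ Y V) (t : ℕ) :
    V (t + 1) = matMul D.W (V t) + D.gradMat (X (t + 1)) (Y (t + 1)) - D.gradMat (X t) (Y t) := by
  ext i : 1
  exact hrun.step_v t i

/-- Mixing preserves averages, so the gradient differences added to the trackers telescope from the
initial gradients. -/
theorem IsDGDMax.avg_V (hrun : D.IsDGDMax ηx ηlam δ X Λ Y V) (hmix : D.MixingAssumption 𝒢)
    (t : ℕ) : avg (V t) = avg (D.gradMat (X t) (Y t)) := by
  induction t with
  | zero =>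
    congr 1
    ext i : 1
    exact hrun.init_v i
  | succ t ih =>
    rw [hrun.V_succ, avg_sub, avg_add, avg_matMul hmix.column_sum, ih]
    abel

theorem IsDGDMax.Λ_succ_sub (hrun : D.IsDGDMax ηx ηlam δ X Λ Y V) (t : ℕ) :
    Λ (t + 1) - Λ t = -(ηlam • D.gradPLam (Y t)) := by
  ext i : 1
  rw [PiLp.sub_apply, hrun.step_lam, add_sub_cancel_left, gradPLam, smul_neg, neg_neg, smul_smul,
    PiLp.smul_apply, matMul_sub_one_apply]
  congr 1
  ring

theorem IsDGDMax.exists_isApproxResponse (hrun : D.IsDGDMax ηx ηlam δ X Λ Y V)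
    (hfun : D.FunAssumption) (hη : 0 < ηx) (hδ : Summable fun t => δ t ^ 2) :
    ∃ e : ℕ → ℝ, (∀ t, 0 ≤ e t) ∧ (Summable fun t => e t ^ 2) ∧
      ∀ t, D.IsApproxResponse (e t) (X t) (Λ t) (Y t) := by
  have hμ := hfun.μ_pos
  have hδ0 := hrun.tol_nonneg
  -- The slack `(1/2)^t` makes the distance bound strict, so that an actual supergradient can be
  -- chosen without asking whether the infimum is attained; it is square-summable.
  refine ⟨fun t => (δ t + (1 / 2) ^ t) / D.μ, fun t => ?_, ?_, fun t i => ?_⟩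
  · have := hδ0 t
    positivity
  · have h1 : Summable fun t : ℕ => ((1 / 2 : ℝ) ^ t) ^ 2 := by
      simp only [← pow_mul, mul_comm _ 2]
      simp only [pow_mul]
      exact summable_geometric_of_lt_one (by norm_num) (by norm_num)
    refine Summable.of_nonneg_of_le (fun t => sq_nonneg _) (fun t => ?_)
      (((hδ.mul_left 2).add (h1.mul_left 2)).div_const (D.μ ^ 2))
    rw [div_pow]
    gcongr
    linarith [sq_nonneg (δ t - (1 / 2 : ℝ) ^ t)]
  · have h1 : Metric.infEDist 0 (superdiff (D.dLoc (X t) (Λ t) i) (Y t i)) <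
        ENNReal.ofReal (δ t + (1 / 2) ^ t) := by
      refine (hrun.approx_y t i).trans_lt ?_
      have := hδ0 t
      rw [ENNReal.ofReal_lt_ofReal_iff (by positivity)]
      have : (0 : ℝ) < (1 / 2) ^ t := by positivity
      linarith
    obtain ⟨ξ, hξ, hlt⟩ := Metric.infEDist_lt_iff.1 h1
    refine ⟨ξ, ?_, ?_⟩
    · rw [mul_div_cancel₀ _ hμ.ne']
      rw [edist_dist, dist_zero_left] at hlt
      exact ((ENNReal.ofReal_lt_ofReal_iff_of_nonneg (norm_nonneg _)).1 hlt).le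
    · rw [shift_apply]
      exact hfun.isOptimalAt_of_superdiff (hrun.mem hfun hη t i) hξ

/-- One row of one inexact response already gives an affine minorant of `h`, and hence exact
maximizers for every agent, every `x ∈ dom g` and every `Λ`. -/
theorem IsApproxResponse.exists_isResponse (hm : 0 < m) (hfun : D.FunAssumption) {e : ℝ}
    {X : RowMat m n₁} {Λ Y : RowMat m n₂} (h : D.IsApproxResponse e X Λ Y) :
    ∃ S, D.IsResponse S := by
  obtain ⟨ξ, -, ho⟩ := h ⟨0, hm⟩
  have haff := ho.exists_affine_le
  have h1 : ∀ x Λ, ∃ Y : RowMat m n₂, x ∈ effDom D.g → ∀ i, D.IsOptimalAt i x (D.shift Λ i) (Y i) := by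
    intro x Λ
    by_cases hx : x ∈ effDom D.g
    · choose y hy using fun i => hfun.exists_isOptimalAt haff i hx (D.shift Λ i)
      exact ⟨WithLp.toLp 2 y, fun _ i => hy i⟩
    · exact ⟨0, fun h => absurd h hx⟩
  choose S hS using h1
  exact ⟨S, fun x hx Λ i => hS x Λ hx i⟩

theorem IsDGDMax.tendsto_zero (hm : 0 < m) (hfun : D.FunAssumption)
    (hmix : D.MixingAssumption 𝒢) (hrun : D.IsDGDMax D.etaX D.etaLam δ X Λ Y V)
    {S : Vec n₁ → RowMat m n₂ → RowMat m n₂} (hS : D.IsResponse S) {e : ℕ → ℝ}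
    (he : ∀ t, 0 ≤ e t) (hes : Summable fun t => e t ^ 2)
    (hY : ∀ t, D.IsApproxResponse (e t) (X t) (Λ t) (Y t)) :
    Tendsto (fun t => avg (X (t + 1)) - avg (X t)) atTop (𝓝 0) ∧
    Tendsto (fun t => Λ (t + 1) - Λ t) atTop (𝓝 0) ∧
    Tendsto (fun t => perp (X t)) atTop (𝓝 0) ∧ Tendsto (fun t => perp (V t)) atTop (𝓝 0) := by
  have hL := hfun.L_pos
  have hρ := hmix.rho_lt_one
  have hr : 0 < 1 - D.rho := by linarith
  have hηx := hfun.etaX_pos hρ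
  have hs := D.smoothConst_pos
  have hm0 : (0 : ℝ) < m := by exact_mod_cast hm
  have hM : 0 < √(m : ℝ) := Real.sqrt_pos.2 hm0
  have hX := hrun.mem hfun hηx
  obtain ⟨M, hMle⟩ := hS.exists_le_phiReal_add hm hfun hmix
  have hsum : Summable fun t => 8 / (1 - D.rho) ^ 2 * (e t + e (t + 1)) ^ 2 := by
    refine Summable.mul_left _ (Summable.of_nonneg_of_le (fun t => sq_nonneg _) (fun t => ?_)
      ((hes.mul_left 2).add (((summable_nat_add_iff 1).2 hes).mul_left 2)))
    linarith [sq_nonneg (e t - e (t + 1))]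
  have h0 := tendsto_zero_of_descent (M := M / D.L)
    (Ψ := fun t => D.lyapunov S (X t) (Λ t) (V t))
    (a := fun t => 2 * ‖avg (X (t + 1)) - avg (X t)‖ ^ 2 + ‖Λ (t + 1) - Λ t‖ ^ 2
      + (‖perp (X t)‖ / √(m : ℝ)) ^ 2
      + 3 / 25 / D.smoothConst * (‖perp (V t)‖ / (D.L * √(m : ℝ))) ^ 2)
    (fun t => ?_) (fun t => by positivity) (fun t => by positivity) hsum
    fun t => lyapunov_le hm hfun hmix hS (he t) (he _) (hX t) (hX _) (hY t) (hY _)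
      (hrun.isProx t) (hrun.Λ_succ_sub t) (hrun.V_succ t) (hrun.avg_V hmix t)
  -- Each of the four sequences, squared and scaled by a positive constant, is dominated by the
  -- vanishing decrease.
  · have key : ∀ {E : Type} [NormedAddCommGroup E] (u : ℕ → E) (c : ℝ), 0 < c →
        (∀ t, c * ‖u t‖ ^ 2 ≤ 2 * ‖avg (X (t + 1)) - avg (X t)‖ ^ 2 + ‖Λ (t + 1) - Λ t‖ ^ 2
          + (‖perp (X t)‖ / √(m : ℝ)) ^ 2
          + 3 / 25 / D.smoothConst * (‖perp (V t)‖ / (D.L * √(m : ℝ))) ^ 2) →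
        Tendsto u atTop (𝓝 0) := by
      intro E _ u c hc hle
      have h1 : Tendsto (fun t => c * ‖u t‖ ^ 2) atTop (𝓝 0) :=
        squeeze_zero (fun t => by positivity) hle h0
      have h2 : Tendsto (fun t => ‖u t‖ ^ 2) atTop (𝓝 0) := by
        have := h1.const_mul c⁻¹
        simpa [hc.ne'] using this
      rw [tendsto_zero_iff_norm_tendsto_zero]
      have := h2.sqrt
      simpa using this
    have hx2 : ∀ t, 0 ≤ ‖avg (X (t + 1)) - avg (X t)‖ ^ 2 := fun t => by positivity
    have hl2 : ∀ t, 0 ≤ ‖Λ (t + 1) - Λ t‖ ^ 2 := fun t => by positivity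
    have ha2 : ∀ t, 0 ≤ (‖perp (X t)‖ / √(m : ℝ)) ^ 2 := fun t => by positivity
    have hb2 : ∀ t, 0 ≤ 3 / 25 / D.smoothConst * (‖perp (V t)‖ / (D.L * √(m : ℝ))) ^ 2 :=
      fun t => by positivity
    refine ⟨key _ 1 one_pos fun t => ?_, key _ 1 one_pos fun t => ?_,
      key _ (1 / √(m : ℝ) ^ 2) (by positivity) fun t => ?_,
      key _ (3 / 25 / D.smoothConst / (D.L * √(m : ℝ)) ^ 2) (by positivity) fun t => ?_⟩
    · linarith [hx2 t, hl2 t, ha2 t, hb2 t]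
    · linarith [hx2 t, hl2 t, ha2 t, hb2 t]
    · have e1 : 1 / √(m : ℝ) ^ 2 * ‖perp (X t)‖ ^ 2 = (‖perp (X t)‖ / √(m : ℝ)) ^ 2 := by ring
      linarith [hx2 t, hl2 t, ha2 t, hb2 t]
    · have e1 : 3 / 25 / D.smoothConst / (D.L * √(m : ℝ)) ^ 2 * ‖perp (V t)‖ ^ 2
          = 3 / 25 / D.smoothConst * (‖perp (V t)‖ / (D.L * √(m : ℝ))) ^ 2 := by ring
      linarith [hx2 t, hl2 t, ha2 t, hb2 t]
  · have h1 := hMle (avg (X t)) (hfun.g_convex.avg_mem hm (hX t)) (Λ t)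
    have h2 : M / D.L ≤ (D.phiReal (avg (X t)) (Λ t) (S (avg (X t)) (Λ t))
      + (D.g (avg (X t))).toReal) / D.L := by gcongr
    have h3 : 0 ≤ 10 * D.smoothConst / (1 - D.rho) ^ 3 * (‖perp (X t)‖ / √(m : ℝ)) ^ 2 := by
      positivity
    have h4 : 0 ≤ 1 / (D.smoothConst * (1 - D.rho)) *
      (‖perp (V t)‖ / (D.L * √(m : ℝ))) ^ 2 := by positivity
    simp only [lyapunov]
    linarith

theorem IsResponse.norm_gradPX_sub_sq_le (hm : 0 < m) (hfun : D.FunAssumption)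
    (hW : specNorm (D.W - 1) ≤ 2) {S : Vec n₁ → RowMat m n₂ → RowMat m n₂} (hS : D.IsResponse S)
    {x x' : Vec n₁} (hx : x ∈ effDom D.g) (hx' : x' ∈ effDom D.g) (Λ Λ' : RowMat m n₂) :
    ‖D.gradPX x' (S x' Λ') - D.gradPX x (S x Λ)‖ ^ 2 ≤
      D.L ^ 2 * (1 + 2 * D.kappa ^ 2) * (‖x' - x‖ ^ 2 + ‖Λ' - Λ‖ ^ 2) := by
  have hμ := hfun.μ_pos
  have hm0 : (0 : ℝ) < m := by exact_mod_cast hm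
  have h1 := hfun.norm_gradMat_sub_sq_le (X := rep m x') (X' := rep m x) (fun _ => hx')
    (fun _ => hx) (fun i => (hS x' hx' Λ' i).1) (fun i => (hS x hx Λ i).1)
  have h2 := norm_avg_sq_le hm (D.gradMat (rep m x') (S x' Λ') - D.gradMat (rep m x) (S x Λ))
  rw [avg_sub, avg_gradMat_rep, avg_gradMat_rep] at h2
  have h3 := hS.norm_sub_sq_le hfun hW hx hx' Λ Λ'
  have h4 : ‖S x' Λ' - S x Λ‖ ^ 2 ≤
      m * (2 * D.kappa ^ 2 * (‖x' - x‖ ^ 2 + ‖Λ' - Λ‖ ^ 2)) := by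
    refine le_of_mul_le_mul_left (h3.trans (le_of_eq ?_)) (pow_pos hμ 2)
    rw [kappa]
    field_simp
  have h5 : ‖rep m x' - rep m x‖ ^ 2 = m * ‖x' - x‖ ^ 2 := by
    rw [← rep_sub, rowMat_norm_sq]
    simp
  rw [h5] at h1
  refine le_of_mul_le_mul_left (h2.trans (h1.trans ?_)) hm0
  have h6 : 0 ≤ ‖Λ' - Λ‖ ^ 2 := by positivity
  have h7 : D.L ^ 2 * (m * ‖x' - x‖ ^ 2 + ‖S x' Λ' - S x Λ‖ ^ 2) ≤ D.L ^ 2 * (m *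
      ((1 + 2 * D.kappa ^ 2) * (‖x' - x‖ ^ 2 + ‖Λ' - Λ‖ ^ 2))) := by
    refine mul_le_mul_of_nonneg_left ?_ (sq_nonneg _)
    have : 0 ≤ m * ‖Λ' - Λ‖ ^ 2 := by positivity
    linarith
  linarith

/-- `∇ₓP` extends continuously from `dom g × ℝ^{m×n₂}` to the whole space. -/
theorem IsResponse.exists_continuous_gradPX (hm : 0 < m) (hfun : D.FunAssumption)
    (hW : specNorm (D.W - 1) ≤ 2) {S : Vec n₁ → RowMat m n₂ → RowMat m n₂}
    (hS : D.IsResponse S) :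
    ∃ Q : WithLp 2 (Vec n₁ × RowMat m n₂) → Vec n₁, Continuous Q ∧
      ∀ x ∈ effDom D.g, ∀ Λ, D.gradPX x (S x Λ) = Q (WithLp.toLp 2 (x, Λ)) := by
  have hlip : LipschitzOnWith (Real.toNNReal √(D.L ^ 2 * (1 + 2 * D.kappa ^ 2)))
      (fun u : WithLp 2 (Vec n₁ × RowMat m n₂) => D.gradPX u.fst (S u.fst u.snd))
      {u | u.fst ∈ effDom D.g} := by
    refine LipschitzOnWith.of_dist_le_mul fun u hu v hv => ?_
    rw [Real.coe_toNNReal _ (Real.sqrt_nonneg _), dist_eq_norm, dist_eq_norm]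
    refine le_of_sq_le_sq ?_ (by positivity)
    rw [mul_pow, Real.sq_sqrt (by positivity), WithLp.prod_norm_sq_eq_of_L2]
    exact hS.norm_gradPX_sub_sq_le hm hfun hW hv hu v.snd u.snd
  -- A Lipschitz map from a subset into a finite-dimensional space extends to a Lipschitz map of the
  -- whole space.
  obtain ⟨Q, hQ, heq⟩ := hlip.extend_finite_dimension
  exact ⟨Q, hQ.continuous, fun x hx Λ => heq (x := WithLp.toLp 2 (x, Λ)) hx⟩

end Problem

end DecMinimax

end

open DecMinimax

/-! ### Passage to the limit. -/

theorem mainTheorem3 {m n₁ n₂ : ℕ} (hm : 0 < m) (𝒢 : SimpleGraph (Fin m))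
    (D : Problem m n₁ n₂)
    (hfun : D.FunAssumption) (hrel : D.RelintAssumption) (hmix : D.MixingAssumption 𝒢)
    (δ : ℕ → ℝ) (hδ : Summable fun t => δ t ^ 2)
    (X : ℕ → RowMat m n₁) (Λ Y : ℕ → RowMat m n₂) (V : ℕ → RowMat m n₁)
    (hrun : D.IsDGDMax D.etaX D.etaLam δ X Λ Y V)
    (Xbar : RowMat m n₁) (Λbar : RowMat m n₂)
    (hlim : MapClusterPt (Xbar, Λbar) Filter.atTop fun t => (X t, Λ t)) :
    perp Xbar = 0 ∧ D.IsStationary (avg Xbar) Λbar := by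
  have hρ := hmix.rho_lt_one
  have hW := hmix.norm_le_two
  have hη := hfun.etaX_pos hρ
  have hm0 : (0 : ℝ) < m := by exact_mod_cast hm
  obtain ⟨e, he, hes, hY⟩ := hrun.exists_isApproxResponse hfun hη hδ
  obtain ⟨S, hS⟩ := (hY 0).exists_isResponse hm hfun
  have hX := hrun.mem hfun hη
  have hx := fun t => hfun.g_convex.avg_mem hm (hX t)
  obtain ⟨hdx, hdΛ, hXp, hVp⟩ := hrun.tendsto_zero hm hfun hmix hS he hes hY
  obtain ⟨τ, hτlim, hτ⟩ := hlim.exists_seq_tendsto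
  have hXlim : Tendsto (fun k => X (τ k)) atTop (𝓝 Xbar) :=
    hτlim.fst_nhds
  have hΛlim : Tendsto (fun k => Λ (τ k)) atTop (𝓝 Λbar) :=
    hτlim.snd_nhds
  have hperp : perp Xbar = 0 :=
    tendsto_nhds_unique ((continuous_perp.tendsto _).comp hXlim) (hXp.comp hτ)
  have hXbar : Xbar = rep m (avg Xbar) := by
    conv_lhs => rw [← rep_avg_add_perp Xbar, hperp, add_zero]
  refine ⟨hperp, ?_⟩
  have hxlim : Tendsto (fun k => avg (X (τ k))) atTop (𝓝 (avg Xbar)) :=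
    (continuous_avg.tendsto _).comp hXlim
  have hesq : Tendsto (fun t => e t ^ 2) atTop (𝓝 0) := hes.tendsto_atTop_zero
  have hXpn : Tendsto (fun t => ‖perp (X t)‖ ^ 2) atTop (𝓝 0) := by
    simpa using hXp.norm.pow 2
  have sq_lim : ∀ {E : Type} [NormedAddCommGroup E] (u : ℕ → E) (B : ℕ → ℝ),
      (∀ k, ‖u k‖ ^ 2 ≤ B k) → Tendsto B atTop (𝓝 0) → Tendsto u atTop (𝓝 0) := by
    intro E _ u B hle hB
    have h2 : Tendsto (fun t => ‖u t‖ ^ 2) atTop (𝓝 0) :=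
      squeeze_zero (fun t => by positivity) hle hB
    rw [tendsto_zero_iff_norm_tendsto_zero]
    simpa using h2.sqrt
  have hNY := fun t => Problem.norm_gradPX_sub_avg_sq_le hm hfun hW hS (hX t) (hY t)
  have hB : Tendsto (fun t => 2 * D.kappa ^ 2 * ‖perp (X t)‖ ^ 2 + 4 * m * e t ^ 2) atTop
      (𝓝 0) := by
    simpa using (hXpn.const_mul (2 * D.kappa ^ 2)).add (hesq.const_mul (4 * (m : ℝ)))
  have hYlim := sq_lim _ _ (fun t => (hNY t).2) hB
  have hVavg : Tendsto (fun t => D.gradPX (avg (X t)) (S (avg (X t)) (Λ t)) - avg (V t)) atTop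
      (𝓝 0) := by
    refine sq_lim _ (fun t => 1 / m * (D.L ^ 2 * ((1 + 2 * D.kappa ^ 2) * ‖perp (X t)‖ ^ 2
      + 4 * m * e t ^ 2))) (fun t => ?_) ?_
    · rw [hrun.avg_V hmix, one_div, ← div_eq_inv_mul, le_div_iff₀ hm0, mul_comm]
      exact (hNY t).1
    · have := (((hXpn.const_mul (1 + 2 * D.kappa ^ 2)).add
        (hesq.const_mul (4 * (m : ℝ)))).const_mul (D.L ^ 2)).const_mul (1 / (m : ℝ))
      simpa using this
  -- At this stage `avg Xbar` is not known to lie in `dom g`, which need not be closed. The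
  -- extension `Q` gives the gradients a limit anyway; membership follows afterwards from the
  -- limiting proximal equation.
  obtain ⟨Q, hQc, hQ⟩ := hS.exists_continuous_gradPX hm hfun hW
  have hQlim : Tendsto (fun k => avg (V (τ k))) atTop
      (𝓝 (Q (WithLp.toLp 2 (avg Xbar, Λbar)))) := by
    have h1 : Tendsto (fun k => Q (WithLp.toLp 2 (avg (X (τ k)), Λ (τ k)))) atTop
        (𝓝 (Q (WithLp.toLp 2 (avg Xbar, Λbar)))) := by
      refine (hQc.tendsto _).comp ?_
      exact ((WithLp.prodContinuousLinearEquiv 2 ℝ (Vec n₁) (RowMat m n₂)).symm.continuous.tendsto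
        _).comp (hxlim.prodMk_nhds hΛlim)
    have h2 := h1.sub (hVavg.comp hτ)
    rw [sub_zero] at h2
    refine h2.congr fun k => ?_
    simp only [Function.comp_apply]
    rw [hQ _ (hx _), sub_sub_cancel]
  have hprox : IsProx (fun u => (D.etaX : EReal) * D.g u)
      (avg Xbar - D.etaX • Q (WithLp.toLp 2 (avg Xbar, Λbar))) (avg Xbar) := by
    -- One row is enough: all rows of `X` share one limit and all rows of `V` another, because the
    -- disagreements vanish.
    let i₀ : Fin m := ⟨0, hm⟩
    have happ : ∀ {n : ℕ}, Continuous fun Z : RowMat m n => Z i₀ := by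
      intro n
      fun_prop
    have hmul : Continuous fun Z : RowMat m n₁ => matMul D.W Z i₀ := by
      simp only [matMul_apply]
      fun_prop
    have hV : Tendsto (fun k => V (τ k) i₀) atTop
        (𝓝 (Q (WithLp.toLp 2 (avg Xbar, Λbar)))) := by
      have h1 := hQlim.add ((happ.tendsto _).comp (hVp.comp hτ))
      simp only [PiLp.zero_apply, add_zero] at h1
      refine h1.congr fun k => ?_
      simp [perp_apply]
    -- The next iterate has the same limit: its average moves by a vanishing amount and its
    -- disagreement vanishes.
    have hXn : Tendsto (fun k => X (τ k + 1) i₀) atTop (𝓝 (avg Xbar)) := by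
      have h1 := ((hdx.comp hτ).add hxlim).add
        ((happ.tendsto _).comp (hXp.comp ((tendsto_add_atTop_nat 1).comp hτ)))
      simp only [PiLp.zero_apply, add_zero, zero_add] at h1
      refine h1.congr fun k => ?_
      simp [perp_apply]
    have hB : Tendsto (fun k => (matMul D.W (X (τ k)) - D.etaX • V (τ k)) i₀) atTop
        (𝓝 (avg Xbar - D.etaX • Q (WithLp.toLp 2 (avg Xbar, Λbar)))) := by
      have h1 : Tendsto (fun k => matMul D.W (X (τ k)) i₀) atTop (𝓝 (avg Xbar)) := by
        have := (hmul.tendsto _).comp hXlim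
        rw [hXbar, matMul_rep hmix.row_sum, rep_apply] at this
        exact this
      exact h1.sub (hV.const_smul _)
    exact hfun.g_convex.isProx_of_tendsto hη hB hXn fun k => hrun.isProx (τ k) i₀
  have hxbar := hfun.g_convex.mem_effDom_of_isProx hη hprox
  refine ⟨_, hS.hasGradOn hm hfun hW hxbar Λbar, ⟨D.etaX, hη, ?_⟩, ?_⟩
  · change IsProx _ (avg Xbar - D.etaX • D.gradPX (avg Xbar) (S (avg Xbar) Λbar)) _
    rw [hQ _ hxbar]
    exact hprox
  · change D.gradPLam (S (avg Xbar) Λbar) = 0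
    have hSlim : Tendsto (fun k => S (avg (X (τ k))) (Λ (τ k)) - S (avg Xbar) Λbar) atTop
        (𝓝 0) := by
      have hμ := hfun.μ_pos
      refine sq_lim _ (fun k => 1 / D.μ ^ 2 * (2 * D.L ^ 2 * (m : ℝ) *
        (‖avg (X (τ k)) - avg Xbar‖ ^ 2 + ‖Λ (τ k) - Λbar‖ ^ 2))) (fun k => ?_) ?_
      · rw [one_div, ← div_eq_inv_mul, le_div_iff₀ (by positivity), mul_comm]
        exact hS.norm_sub_sq_le hfun hW hxbar (hx _) Λbar (Λ (τ k))
      · have := (((((hxlim.sub_const (avg Xbar)).norm.pow 2).add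
          ((hΛlim.sub_const Λbar).norm.pow 2)).const_mul (2 * D.L ^ 2 * (m : ℝ))).const_mul
            (1 / D.μ ^ 2))
        simpa using this
    have hc : Continuous fun Z : RowMat m n₂ => D.gradPLam Z := by
      have : Continuous fun Z : RowMat m n₂ => matMul (D.W - 1) Z := by
        unfold matMul
        fun_prop
      unfold Problem.gradPLam
      fun_prop
    -- `Y` approaches the maximizers at the current average, and these converge to the maximizers at
    -- the limit by Lipschitz stability.
    have hYS : Tendsto (fun k => Y (τ k)) atTop (𝓝 (S (avg Xbar) Λbar)) := by
      have h1 := (hSlim.sub (hYlim.comp hτ)).add_const (S (avg Xbar) Λbar)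
      simp only [sub_zero, zero_add] at h1
      refine h1.congr fun k => ?_
      simp
    have h1 := (hc.tendsto _).comp hYS
    -- The multiplier update expresses this gradient as `-(1/ηλ)` times the increment of `Λ`.
    have h2 : Tendsto (fun k => D.gradPLam (Y (τ k))) atTop (𝓝 0) := by
      have h3 := (hdΛ.comp hτ).const_smul (-(1 / D.etaLam))
      rw [smul_zero] at h3
      refine h3.congr fun k => ?_
      simp only [Function.comp_apply]
      rw [hrun.Λ_succ_sub, smul_neg, neg_smul, neg_neg, smul_smul,
        one_div_mul_cancel (hfun.etaLam_pos hρ).ne', one_smul]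
    exact tendsto_nhds_unique h1 h2
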